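/- Let $\mathbb S^2$ be the unit sphere in $\mathbb R^3$, $\sigma$ its surface area measure normalised to $\sigma(\mathbb S^2)=1$, $\vartheta$ the geodesic distance on $\mathbb S^2$, and $C(\mathbf x,\rho)=\{\mathbf y\in\mathbb S^2 : \vartheta(\mathbf x,\mathbf y)<\rho\}$. For $A\subset\mathbb S^2$ put $$M_\rho(A)=\int_{A}\sigma\bigl(C(\mathbf x,\rho)\setminus A\bigr)\,d\sigma(\mathbf x).$$ For a smooth (i.e. $C^\infty$ with a regular parametrisation) simple closed curve $\mathcal C\subset\mathbb S^2$ let $L(\mathcal C)$ be its length, and for $\theta>0$ let the tube $T(\mathcal C,\theta)$ be the set of all $\mathbf x\in\mathbb S^2$ that are joined to $\mathcal C$ by a geodesic of length at most $\theta$ meeting $\mathcal C$ orthogonally. The tube $T(\mathcal C,\theta)$ does not overlap itself if no point of it has more than one such geodesic of length at most $\theta$. **Lemma.** Let $A\subset\mathbb S^2$ be a set whose boundary $\partial A$ is a smooth simple closed curve, and such that both $A$ and $\mathbb S^2\setminus A$ have non-empty interior. Let $0<\hat r<\pi/2$ be such that for every $0<\theta<\hat r$ the tube $T(\partial A,\theta)$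 does not overlap itself. Then for every $0<\rho<\hat r/2$ $$\left|M_\rho(A)-L(\partial A)\,\frac{\rho^3}{24\pi^2}\right|\le L(\partial A)\,\hat r^{-1}\rho^4 .$$ -/

import Mathlib

open MeasureTheory Set

noncomputable section

namespace SphereTube

/-- Euclidean three-space. -/
abbrev E3 : Type := EuclideanSpace ℝ (Fin 3)

/-- The unit sphere in Euclidean three-space. -/
abbrev S2 : Type := Metric.sphere (0 : E3) 1

/-- The normalised surface area measure on the unit sphere. -/
def sigma : Measure S2 :=
  ((volume : Measure E3).toSphere univ)⁻¹ • (volume : Measure E3).toSphere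

/-- The geodesic distance on the sphere: the angle between two unit vectors. -/
def geodesicDist (x y : S2) : ℝ :=
  InnerProductGeometry.angle (x : E3) (y : E3)

/-- The open spherical cap with centre `x` and angular radius `ρ`. -/
def cap (x : S2) (ρ : ℝ) : Set S2 :=
  {y | geodesicDist x y < ρ}

/-- The integral over `x ∈ A` of the normalised area of the part of the cap of radius `ρ` around
`x` that lies outside `A`. The integrand and the total mass are at most one, so the
extended nonnegative integral is finite. -/
def M (ρ : ℝ) (A : Set S2) : ℝ :=
  (∫⁻ x in A, sigma (cap x ρ \ A) ∂sigma).toReal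

/-- The velocity of a curve on the sphere, as a vector of the ambient space. -/
def velocity (γ : ℝ → S2) (t : ℝ) : E3 :=
  deriv (fun s => (γ s : E3)) t

/-- `γ` is a regular smooth parametrisation, with period one, of a simple closed curve. -/
structure IsSmoothSimpleClosedCurve (γ : ℝ → S2) : Prop where
  smooth : ContDiff ℝ (⊤ : ℕ∞) (fun s => (γ s : E3))
  regular : ∀ t, velocity γ t ≠ 0
  periodic : Function.Periodic γ 1
  simple : InjOn γ (Ico 0 1)

/-- The length of a closed curve parametrised with period one. -/
def curveLength (γ : ℝ → S2) : ℝ :=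
  ∫ t in (0 : ℝ)..1, ‖velocity γ t‖

/-- The end point of the geodesic of the unit sphere that starts at the unit vector `p` with
initial velocity `w` (tangent to the sphere at `p`) and runs for unit time; the length of this
geodesic is `‖w‖`. -/
def geodesicEnd (p w : E3) : E3 :=
  Real.cos ‖w‖ • p + Real.sinc ‖w‖ • w

/-- The geodesic segments of length at most `θ` that start on the curve `γ` orthogonally to it.
Such a segment is recorded by its starting point and its initial velocity. -/
def orthogonalGeodesics (γ : ℝ → S2) (θ : ℝ) : Set (E3 × E3) :=
  {g | ∃ t : ℝ, g.1 = (γ t : E3) ∧ inner ℝ g.2 (γ t : E3) = 0 ∧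
    inner ℝ g.2 (velocity γ t) = 0 ∧ ‖g.2‖ ≤ θ}

/-- The tube of radius `θ` around the curve `γ`: the points of the sphere that are joined to the
curve by a geodesic of length at most `θ` meeting the curve orthogonally. -/
def tube (γ : ℝ → S2) (θ : ℝ) : Set S2 :=
  {x | ∃ g ∈ orthogonalGeodesics γ θ, geodesicEnd g.1 g.2 = (x : E3)}

/-- The tube of radius `θ` around `γ` does not overlap itself: no point of it has more than one
geodesic of length at most `θ` that meets the curve orthogonally. -/
def TubeNoOverlap (γ : ℝ → S2) (θ : ℝ) : Prop :=
  ∀ x ∈ tube γ θ, ∃! g : E3 × E3,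
    g ∈ orthogonalGeodesics γ θ ∧ geodesicEnd g.1 g.2 = (x : E3)

end SphereTube

end

/-! Only points of `A` within distance `ρ` of the curve contribute to `M ρ A`. Such a point is
`tubePoint (t, s)`, at depth `s` along the inner normal `n` at `γ t`, and the non-overlap hypothesis
makes `(t, s)` injective coordinates there. In them the area element is `|cos s - k sin s| ‖γ'‖ ds
dt / (4π)`, with `k` the geodesic curvature.

Seen from depth `s`, the part of the cap outside `A` is nearly the part of a flat disc of radius `ρ`
beyond a line at distance `s`, of area `V(s) = ∫_s^ρ 2√(ρ² - u²) du`. Since `∫_0^ρ V = 2ρ³/3` and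
the normalisation contributes `1/(4π)` twice, the main term is `L · (2ρ³/3) / (16π²) = L ρ³ /
(24π²)`.

Both errors are controlled by nearest points. A nearest point of the curve is always the foot of an
orthogonal geodesic, so by non-overlap the cap of radius `θ < r` centred at distance `θ` along
either normal misses the curve (`inner_tubePoint_le`). Taking `θ = 3r/4` gives two caps touching the
curve at `γ t`, one in `A` and one in the complement. They confine the boundary to a strip of
half-width `10ρ²/r` about the line (`sigma_cap_sdiff_bounds`). The second-order condition at a
nearest point gives `|k| ≤ 4/(3r)`, so the Jacobian differs from 1 by at most `2s/r`
(`abs_jacobian_sub_one_le`). Together these change `V(s)` by at most `84ρ³/r`, and `84/(16π²) < 1`.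
-/

open scoped Pointwise

noncomputable section

namespace SphereTube

/-! ### Determinants and the area of parametrised pieces of the sphere. -/

/-- The determinant of three vectors in the standard basis of Euclidean three-space. -/
def det3 (a b c : E3) : ℝ :=
  (EuclideanSpace.basisFun (Fin 3) ℝ).toBasis.det ![a, b, c]

lemma det3_smul (x y z : ℝ) (a b c : E3) :
    det3 (x • a) (y • b) (z • c) = x * y * z * det3 a b c := by
  simp only [det3, Module.Basis.det_apply, Matrix.det_fin_three, Module.Basis.toMatrix_apply]
  simp
  ring

/-- Reads a Jacobian off its three columns, the partial derivatives. -/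
lemma linearMap_det_eq_det3 (f : E3 →ₗ[ℝ] E3) :
    LinearMap.det f = det3 (f (EuclideanSpace.single 0 1)) (f (EuclideanSpace.single 1 1))
      (f (EuclideanSpace.single 2 1)) := by
  have h := (EuclideanSpace.basisFun (Fin 3) ℝ).toBasis.det_comp f
    (EuclideanSpace.basisFun (Fin 3) ℝ).toBasis
  rw [Module.Basis.det_self, mul_one] at h
  rw [← h, det3]
  congr 1
  ext i : 1
  fin_cases i <;> simp

lemma abs_det3_of_orthonormal {a b c : E3} (h : Orthonormal ℝ ![a, b, c]) :
    |det3 a b c| = 1 := by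
  -- The extension theorem works with a family restricted to an index set; using every index makes
  -- the triple itself a basis.
  have h' : Orthonormal ℝ ((univ : Set (Fin 3)).domRestrict ![a, b, c]) :=
    h.comp _ Subtype.val_injective
  obtain ⟨B, hB⟩ := Orthonormal.exists_orthonormalBasis_extension_of_card_eq (by simp) h'
  have hB' : ⇑B = ![a, b, c] := funext fun i => hB i (mem_univ i)
  rcases (EuclideanSpace.basisFun (Fin 3) ℝ).det_to_matrix_orthonormalBasis_real B with h1 | h1 <;>
    rw [hB'] at h1 <;> simp [det3, h1]

lemma orthonormal_decomposition {a b c : E3} (h : Orthonormal ℝ ![a, b, c]) (x : E3) :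
    x = inner ℝ a x • a + inner ℝ b x • b + inner ℝ c x • c := by
  have h' : Orthonormal ℝ ((univ : Set (Fin 3)).domRestrict ![a, b, c]) :=
    h.comp _ Subtype.val_injective
  obtain ⟨B, hB⟩ := Orthonormal.exists_orthonormalBasis_extension_of_card_eq (by simp) h'
  have h1 := B.sum_repr' x
  rw [Fin.sum_univ_three, hB 0 (mem_univ _), hB 1 (mem_univ _), hB 2 (mem_univ _)] at h1
  exact h1.symm

lemma orthonormal_triple {a b c : E3} (ha : inner ℝ a a = (1 : ℝ)) (hb : inner ℝ b b = (1 : ℝ))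
    (hc : inner ℝ c c = (1 : ℝ)) (hab : inner ℝ a b = (0 : ℝ)) (hac : inner ℝ a c = (0 : ℝ))
    (hbc : inner ℝ b c = (0 : ℝ)) : Orthonormal ℝ ![a, b, c] := by
  rw [orthonormal_iff_ite]
  intro i j
  fin_cases i <;> fin_cases j <;> simp_all [real_inner_comm]

/-- Splitting off the first coordinate of Euclidean three-space preserves volume. -/
lemma measurePreserving_splitFirst :
    MeasurePreserving (fun v : E3 => ((v 1, v 2), v 0)) volume volume := by
  have h1 := PiLp.volume_preserving_ofLp (Fin 3)
  have h2 := volume_preserving_piFinSuccAbove (fun _ : Fin 3 => ℝ) 0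
  have h3 := volume_preserving_finTwoArrow ℝ
  have h4 : MeasurePreserving (Prod.map (id : ℝ → ℝ) (MeasurableEquiv.finTwoArrow (α := ℝ)))
    volume volume := (MeasurePreserving.id volume).prod h3
  have h5 := Measure.measurePreserving_swap (μ := (volume : Measure ℝ))
    (ν := (volume : Measure (ℝ × ℝ)))
  exact h5.comp (h4.comp (h2.comp h1))

/-- The radial integral over a cone: with `a = ‖P w‖`, the ray through `P w` meets the sphere at
parameter `1 / a`. -/
lemma lintegral_Ioo_mul_sq {a j : ℝ} (ha : 0 < a) (hj : 0 ≤ j) :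
    ∫⁻ l in Ioo 0 (1 / a), ENNReal.ofReal (l ^ 2 * j) = ENNReal.ofReal (j / a ^ 3 / 3) := by
  have h0 : (0 : ℝ) ≤ 1 / a := by positivity
  rw [Measure.restrict_congr_set Ioo_ae_eq_Ioc, ← ofReal_integral_eq_lintegral_ofReal,
    ← intervalIntegral.integral_of_le h0]
  · rw [intervalIntegral.integral_mul_const, integral_pow]
    congr 1
    have ha' : a ≠ 0 := ha.ne'
    norm_num
    field_simp
  · exact ((continuous_id.pow 2).mul continuous_const).integrableOn_Ioc
  · exact Filter.Eventually.of_forall fun l => by positivity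

lemma toSphere_univ_E3 :
    (volume : Measure E3).toSphere univ = ENNReal.ofReal (4 * Real.pi) := by
  rw [Measure.toSphere_apply_univ, EuclideanSpace.volume_ball_fin_three]
  rw [finrank_euclideanSpace_fin, ENNReal.ofReal_one, one_pow, one_mul,
    ← ENNReal.ofReal_natCast, ← ENNReal.ofReal_mul (by positivity)]
  congr 1
  push_cast
  ring

/-- `toSphere` is the dimension 3 times the volume of the cone over the set, and the total mass is
`4π`. -/
lemma sigma_apply {S : Set S2} (hS : MeasurableSet S) :
    sigma S = ENNReal.ofReal (3 / (4 * Real.pi)) *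
      (volume : Measure E3) (Ioo (0 : ℝ) 1 • ((↑) '' S : Set E3)) := by
  have hp := Real.pi_pos
  rw [sigma, Measure.smul_apply, Measure.toSphere_apply' _ hS, toSphere_univ_E3, smul_eq_mul,
    finrank_euclideanSpace_fin, ← ENNReal.ofReal_natCast, ← mul_assoc,
    ← ENNReal.ofReal_inv_of_pos (by positivity), ← ENNReal.ofReal_mul (by positivity)]
  congr 2
  push_cast
  field_simp

/-- Area of a parametrised piece of the sphere: the parametrisation `Q` is the central projection
of a parametrised surface `P` that avoids the origin. -/
theorem sigma_image {D : Set (ℝ × ℝ)} (hD : MeasurableSet D) {P : ℝ × ℝ → E3}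
    {P' : ℝ × ℝ → (ℝ × ℝ →L[ℝ] E3)} (hP : ∀ w, HasFDerivAt P (P' w) w)
    {Q : ℝ × ℝ → S2} (hQ : Continuous Q) (hPQ : ∀ w, P w = ‖P w‖ • (Q w : E3))
    (hP0 : ∀ w, P w ≠ 0) (hinj : InjOn Q D) {J : ℝ × ℝ → ℝ} (hJ : Measurable J)
    (hdet : ∀ w ∈ D, |det3 (P w) (P' w (1, 0)) (P' w (0, 1))| = J w) :
    sigma (Q '' D) = ENNReal.ofReal (1 / (4 * Real.pi)) *
      ∫⁻ w in D, ENNReal.ofReal (J w / ‖P w‖ ^ 3) := by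
  have hPc : Continuous P := continuous_iff_continuousAt.2 fun w => (hP w).continuousAt
  have hpos : ∀ w, 0 < ‖P w‖ := fun w => norm_pos_iff.2 (hP0 w)
  have hQD : MeasurableSet (Q '' D) := hD.image_of_continuousOn_injOn hQ.continuousOn hinj
  set pr : E3 → ℝ × ℝ := fun v => (v 1, v 2) with hpr
  set pL : E3 →L[ℝ] ℝ × ℝ :=
    (EuclideanSpace.proj 1 : E3 →L[ℝ] ℝ).prod (EuclideanSpace.proj 2 : E3 →L[ℝ] ℝ) with hpL
  -- `F` parametrises the solid cone: the first coordinate scales the ray, the other two are the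
  -- surface parameters. Its Jacobian is the square of the first coordinate times `J`.
  set F : E3 → E3 := fun v => v 0 • P (pr v) with hF
  set F' : E3 → (E3 →L[ℝ] E3) := fun v =>
    v 0 • ((P' (pr v)).comp pL) +
      ((EuclideanSpace.proj 0 : E3 →L[ℝ] ℝ)).smulRight (P (pr v)) with hF'
  have hFd : ∀ v, HasFDerivAt F (F' v) v := by
    intro v
    have h1 : HasFDerivAt (fun v : E3 => v 0) (EuclideanSpace.proj 0 : E3 →L[ℝ] ℝ) v :=
      (EuclideanSpace.proj 0 : E3 →L[ℝ] ℝ).hasFDerivAt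
    have h2 : HasFDerivAt (fun v => P (pr v)) ((P' (pr v)).comp pL) v :=
      (hP (pr v)).comp v pL.hasFDerivAt
    exact h1.smul h2
  set T : Set ((ℝ × ℝ) × ℝ) := {z | z.1 ∈ D ∧ 0 < z.2 ∧ z.2 < 1 / ‖P z.1‖} with hT
  have hTm : MeasurableSet T := by
    refine (measurable_fst hD).inter ((measurableSet_lt measurable_const measurable_snd).inter
      (measurableSet_lt measurable_snd ?_))
    exact measurable_const.div (hPc.measurable.comp measurable_fst).norm
  set S : Set E3 := (fun v : E3 => ((v 1, v 2), v 0)) ⁻¹' T with hS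
  have hSm : MeasurableSet S := measurePreserving_splitFirst.measurable hTm
  have hFnorm : ∀ v : E3, 0 < v 0 → ‖F v‖ = v 0 * ‖P (pr v)‖ := by
    intro v hv
    rw [hF, norm_smul, Real.norm_eq_abs, abs_of_pos hv]
  have hFinj : InjOn F S := by
    intro v hv u hu h
    obtain ⟨hv1, hv2, -⟩ := hv
    obtain ⟨hu1, hu2, -⟩ := hu
    have hn : v 0 * ‖P (pr v)‖ = u 0 * ‖P (pr u)‖ := by
      rw [← hFnorm v hv2, ← hFnorm u hu2, h]
    have hne : v 0 * ‖P (pr v)‖ ≠ 0 := (mul_pos hv2 (hpos _)).ne'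
    have hq : pr v = pr u := by
      apply hinj hv1 hu1
      apply Subtype.ext
      have h3 : (v 0 * ‖P (pr v)‖) • (Q (pr v) : E3) = (v 0 * ‖P (pr v)‖) • (Q (pr u) : E3) := by
        conv_rhs => rw [hn]
        rw [mul_smul, mul_smul, ← hPQ, ← hPQ]
        exact h
      exact smul_right_injective E3 hne h3
    have h0 : v 0 = u 0 := by
      rw [hq] at hn
      exact mul_right_cancel₀ (hpos _).ne' hn
    have h1 : v 1 = u 1 := congrArg Prod.fst hq
    have h2 : v 2 = u 2 := congrArg Prod.snd hq
    ext i
    fin_cases i <;> assumption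
  have himg : Ioo (0 : ℝ) 1 • ((↑) '' (Q '' D) : Set E3) = F '' S := by
    ext y
    constructor
    · rintro ⟨l, hl, _, ⟨_, ⟨w, hw, rfl⟩, rfl⟩, rfl⟩
      refine ⟨!₂[l / ‖P w‖, w.1, w.2], ⟨hw, ?_, ?_⟩, ?_⟩
      · exact div_pos hl.1 (hpos w)
      · exact div_lt_div_of_pos_right hl.2 (hpos w)
      · change (l / ‖P w‖) • P w = l • (Q w : E3)
        conv_lhs => rw [hPQ w, smul_smul, ← hPQ w, div_mul_cancel₀ _ (hpos w).ne']
    · rintro ⟨v, ⟨hv1, hv2, hv3⟩, rfl⟩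
      refine ⟨v 0 * ‖P (pr v)‖, ⟨mul_pos hv2 (hpos _), ?_⟩, Q (pr v),
        ⟨Q (pr v), ⟨pr v, hv1, rfl⟩, rfl⟩, ?_⟩
      · exact (lt_div_iff₀ (hpos _)).1 hv3
      · change (v 0 * ‖P (pr v)‖) • (Q (pr v) : E3) = v 0 • P (pr v)
        rw [mul_smul, ← hPQ]
  have hdetF : ∀ v ∈ S, |(F' v).det| = v 0 ^ 2 * J (pr v) := by
    intro v hv
    have e0 : F' v (EuclideanSpace.single 0 1) = (1 : ℝ) • P (pr v) := by
      have hz : pL (EuclideanSpace.single 0 1) = 0 := by simp [hpL]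
      simp [hF', hz]
    have e1 : F' v (EuclideanSpace.single 1 1) = v 0 • P' (pr v) (1, 0) := by
      simp [hF', hpL]
    have e2 : F' v (EuclideanSpace.single 2 1) = v 0 • P' (pr v) (0, 1) := by
      simp [hF', hpL]
    rw [ContinuousLinearMap.det, linearMap_det_eq_det3]
    simp only [ContinuousLinearMap.coe_coe]
    rw [e0, e1, e2, det3_smul, abs_mul, hdet _ hv.1, one_mul, ← sq, abs_of_nonneg (sq_nonneg _)]
  rw [sigma_apply hQD, himg, ← lintegral_abs_det_fderiv_eq_addHaar_image volume hSm
    (fun v _ => (hFd v).hasFDerivWithinAt) hFinj]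
  have hstep : ∫⁻ v in S, ENNReal.ofReal |(F' v).det| =
      ∫⁻ w in D, ENNReal.ofReal (J w / ‖P w‖ ^ 3 / 3) := by
    rw [setLIntegral_congr_fun hSm (fun v hv => by rw [hdetF v hv])]
    have hg : Measurable fun z : (ℝ × ℝ) × ℝ => ENNReal.ofReal (z.2 ^ 2 * J z.1) :=
      ((measurable_snd.pow_const 2).mul (hJ.comp measurable_fst)).ennreal_ofReal
    have h1 := measurePreserving_splitFirst.setLIntegral_comp_preimage hTm hg
    refine h1.trans ?_
    rw [← lintegral_indicator hTm, ← lintegral_indicator hD, Measure.volume_eq_prod,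
      lintegral_prod _ (hg.indicator hTm).aemeasurable]
    refine lintegral_congr fun w => ?_
    by_cases hw : w ∈ D
    · rw [indicator_of_mem hw, ← lintegral_Ioo_mul_sq (hpos w)
        (by rw [← hdet w hw]; exact abs_nonneg _), ← lintegral_indicator measurableSet_Ioo]
      refine lintegral_congr fun l => ?_
      by_cases hl : l ∈ Ioo 0 (1 / ‖P w‖)
      · rw [indicator_of_mem hl, indicator_of_mem (show (w, l) ∈ T from ⟨hw, hl.1, hl.2⟩)]
      · rw [indicator_of_notMem hl, indicator_of_notMem fun h : (w, l) ∈ T => hl ⟨h.2.1, h.2.2⟩]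
    · rw [indicator_of_notMem hw]
      refine (lintegral_congr fun l => indicator_of_notMem (fun h => hw h.1) _).trans ?_
      simp
  have hsplit : ∀ w, ENNReal.ofReal (J w / ‖P w‖ ^ 3 / 3) =
      ENNReal.ofReal (1 / 3) * ENNReal.ofReal (J w / ‖P w‖ ^ 3) := fun w => by
    rw [← ENNReal.ofReal_mul (by norm_num)]
    congr 1
    ring
  have hm : Measurable fun w => ENNReal.ofReal (J w / ‖P w‖ ^ 3) :=
    (hJ.div (hPc.measurable.norm.pow_const 3)).ennreal_ofReal
  rw [hstep, lintegral_congr hsplit, lintegral_const_mul _ hm, ← mul_assoc,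
    ← ENNReal.ofReal_mul (by positivity)]
  congr 2
  field_simp

instance : IsFiniteMeasure sigma := by
  refine ⟨?_⟩
  rw [sigma_apply MeasurableSet.univ, image_univ, Subtype.range_coe]
  refine ENNReal.mul_lt_top ENNReal.ofReal_lt_top ?_
  have h : Ioo (0 : ℝ) 1 • Metric.sphere (0 : E3) 1 ⊆ Metric.ball 0 1 := by
    rintro _ ⟨l, hl, v, hv, rfl⟩
    have hv' : ‖v‖ = 1 := by simpa using hv
    simp only [Metric.mem_ball, dist_zero_right, norm_smul, hv', mul_one, Real.norm_eq_abs,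
      abs_of_pos hl.1, hl.2]
  exact (measure_mono h).trans_lt measure_ball_lt_top

/-- The change of variables formula belonging to `sigma_image`. -/
theorem setLIntegral_image_sigma {D : Set (ℝ × ℝ)} (hD : MeasurableSet D) {P : ℝ × ℝ → E3}
    {P' : ℝ × ℝ → (ℝ × ℝ →L[ℝ] E3)} (hP : ∀ w, HasFDerivAt P (P' w) w)
    {Q : ℝ × ℝ → S2} (hQ : Continuous Q) (hPQ : ∀ w, P w = ‖P w‖ • (Q w : E3))
    (hP0 : ∀ w, P w ≠ 0) (hinj : InjOn Q D) {J : ℝ × ℝ → ℝ} (hJ : Measurable J)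
    (hdet : ∀ w ∈ D, |det3 (P w) (P' w (1, 0)) (P' w (0, 1))| = J w)
    {f : S2 → ENNReal} (hf : Measurable f) :
    ∫⁻ x in Q '' D, f x ∂sigma = ENNReal.ofReal (1 / (4 * Real.pi)) *
      ∫⁻ w in D, ENNReal.ofReal (J w / ‖P w‖ ^ 3) * f (Q w) := by
  have hPc : Continuous P := continuous_iff_continuousAt.2 fun w => (hP w).continuousAt
  have hm : Measurable fun w => ENNReal.ofReal (J w / ‖P w‖ ^ 3) :=
    (hJ.div (hPc.measurable.norm.pow_const 3)).ennreal_ofReal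
  have hQD : MeasurableSet (Q '' D) := hD.image_of_continuousOn_injOn hQ.continuousOn hinj
  -- The two measures agree on every measurable `S` by applying `sigma_image` to `D ∩ Q ⁻¹' S`.
  have hmeas : sigma.restrict (Q '' D) = ENNReal.ofReal (1 / (4 * Real.pi)) •
      (((volume.restrict D).withDensity fun w => ENNReal.ofReal (J w / ‖P w‖ ^ 3)).map Q) := by
    ext S hS
    have hS' : MeasurableSet (Q ⁻¹' S) := hQ.measurable hS
    rw [Measure.restrict_apply hS, Measure.smul_apply, Measure.map_apply hQ.measurable hS,
      withDensity_apply _ hS', Measure.restrict_restrict hS', inter_comm S, ← image_inter_preimage,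
      sigma_image (hD.inter hS') hP hQ hPQ hP0 (hinj.mono inter_subset_left) hJ
        (fun w hw => hdet w hw.1), smul_eq_mul, inter_comm D]
  rw [hmeas, lintegral_smul_measure, lintegral_map hf hQ.measurable,
    lintegral_withDensity_eq_lintegral_mul _ hm
      (show Measurable fun w => f (Q w) from hf.comp hQ.measurable), smul_eq_mul]
  rfl

/-! ### Areas of discs, annuli and disc segments in the plane. -/

/-- The part of the open disc of radius `ρ` to the right of the line with abscissa `s`. -/
def discPart (ρ s : ℝ) : Set (ℝ × ℝ) :=
  {w | s < w.1 ∧ w.1 ^ 2 + w.2 ^ 2 < ρ ^ 2}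

/-- The area of `discPart ρ s`. -/
def discPartArea (ρ s : ℝ) : ℝ :=
  ∫ u in s..ρ, 2 * √(ρ ^ 2 - u ^ 2)

lemma continuous_two_mul_sqrt (ρ : ℝ) : Continuous fun u : ℝ => 2 * √(ρ ^ 2 - u ^ 2) := by
  fun_prop

lemma volume_discPart {ρ s : ℝ} (hs : -ρ ≤ s) (hsρ : s ≤ ρ) :
    volume (discPart ρ s) = ENNReal.ofReal (discPartArea ρ s) := by
  have h : discPart ρ s =
      regionBetween (fun u => -√(ρ ^ 2 - u ^ 2)) (fun u => √(ρ ^ 2 - u ^ 2)) (Ioc s ρ) := by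
    ext ⟨a, b⟩
    simp only [discPart, regionBetween, mem_ofPred_eq, mem_Ioc, mem_Ioo]
    constructor
    · rintro ⟨h1, h2⟩
      have h3 : |b| < √(ρ ^ 2 - a ^ 2) := Real.lt_sqrt_of_sq_lt (by rw [sq_abs]; linarith)
      have h4 : a ^ 2 < ρ ^ 2 := by nlinarith [sq_nonneg b]
      exact ⟨⟨h1, by nlinarith⟩, abs_lt.1 h3⟩
    · rintro ⟨⟨h1, h2⟩, h3⟩
      have h4 := (Real.lt_sqrt (abs_nonneg b)).1 (abs_lt.2 h3)
      rw [sq_abs] at h4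
      exact ⟨h1, by linarith⟩
  have hi : ∀ f : ℝ → ℝ, Continuous f → IntegrableOn f (Ioc s ρ) volume := fun f hf =>
    hf.integrableOn_Ioc
  rw [h, Measure.volume_eq_prod, volume_regionBetween_eq_integral (hi _ (by fun_prop)) (hi _ (by fun_prop))
    measurableSet_Ioc (fun u _ => by linarith [Real.sqrt_nonneg (ρ ^ 2 - u ^ 2)]), discPartArea,
    intervalIntegral.integral_of_le hsρ]
  congr 1
  refine integral_congr_ae (Filter.Eventually.of_forall fun u => ?_)
  simp only [Pi.sub_apply]
  ring

lemma hasDerivAt_discPartArea (ρ s : ℝ) :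
    HasDerivAt (discPartArea ρ) (-(2 * √(ρ ^ 2 - s ^ 2))) s :=
  intervalIntegral.integral_hasDerivAt_left
    ((continuous_two_mul_sqrt ρ).intervalIntegrable _ _)
    ((continuous_two_mul_sqrt ρ).stronglyMeasurableAtFilter _ _)
    (continuous_two_mul_sqrt ρ).continuousAt

lemma continuous_discPartArea (ρ : ℝ) : Continuous (discPartArea ρ) :=
  continuous_iff_continuousAt.2 fun s => (hasDerivAt_discPartArea ρ s).continuousAt

lemma discPartArea_nonneg {ρ s : ℝ} (hs : s ≤ ρ) : 0 ≤ discPartArea ρ s :=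
  intervalIntegral.integral_nonneg hs fun u _ => by positivity

lemma discPartArea_le {ρ s : ℝ} (hρ : 0 ≤ ρ) (h0 : 0 ≤ s) (hs : s ≤ ρ) :
    discPartArea ρ s ≤ 2 * ρ ^ 2 := by
  have h : discPartArea ρ s ≤ ∫ u in s..ρ, 2 * ρ := by
    refine intervalIntegral.integral_mono_on hs
      ((continuous_two_mul_sqrt ρ).intervalIntegrable _ _) (by simp) fun u _ => ?_
    have : √(ρ ^ 2 - u ^ 2) ≤ ρ := Real.sqrt_le_iff.2 ⟨hρ, by nlinarith [sq_nonneg u]⟩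
    linarith
  rw [intervalIntegral.integral_const, smul_eq_mul] at h
  nlinarith

/-- Integration by parts against `s`: both boundary terms vanish, leaving `∫ 2 s √(ρ² - s²)`. -/
lemma integral_discPartArea {ρ : ℝ} (hρ : 0 ≤ ρ) :
    ∫ s in (0 : ℝ)..ρ, discPartArea ρ s = 2 * ρ ^ 3 / 3 := by
  have h1 := intervalIntegral.integral_mul_deriv_eq_deriv_mul (a := 0) (b := ρ)
    (u := discPartArea ρ) (v := id) (u' := fun s => -(2 * √(ρ ^ 2 - s ^ 2))) (v' := fun _ => 1)
    (fun s _ => hasDerivAt_discPartArea ρ s) (fun s _ => hasDerivAt_id s)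
    ((continuous_two_mul_sqrt ρ).neg.intervalIntegrable _ _) (by simp)
  have h2 : ∫ s in (0 : ℝ)..ρ, -(2 * √(ρ ^ 2 - s ^ 2)) * s = -(2 * ρ ^ 3 / 3) := by
    have h3 : ∀ s ∈ Ioo (0 : ℝ) ρ, HasDerivAt
        (fun s => 2 / 3 * ((ρ ^ 2 - s ^ 2) * √(ρ ^ 2 - s ^ 2)))
        (-(2 * √(ρ ^ 2 - s ^ 2)) * s) s := by
      intro s hs
      have hpos : 0 < ρ ^ 2 - s ^ 2 := by nlinarith [hs.1, hs.2]
      have hq : HasDerivAt (fun s : ℝ => ρ ^ 2 - s ^ 2) (-(2 * s)) s := by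
        simpa using ((hasDerivAt_id s).pow 2).const_sub (ρ ^ 2)
      have := (hq.mul (hq.sqrt hpos.ne')).const_mul (2 / 3 : ℝ)
      refine this.congr_deriv ?_
      have hsq := Real.sq_sqrt hpos.le
      have hne : √(ρ ^ 2 - s ^ 2) ≠ 0 := (Real.sqrt_pos.2 hpos).ne'
      generalize √(ρ ^ 2 - s ^ 2) = q at hsq hne
      rw [← hsq]
      field_simp
      ring
    rw [intervalIntegral.integral_eq_sub_of_hasDerivAt_of_le hρ (by fun_prop) h3
      (Continuous.intervalIntegrable (by fun_prop) _ _)]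
    have h4 : √(ρ ^ 2) = ρ := Real.sqrt_sq hρ
    simp [h4]
    ring
  have h5 : discPartArea ρ ρ = 0 := intervalIntegral.integral_same
  simp only [mul_one, id, h2, h5] at h1
  rw [h1]
  ring

lemma volume_disc {ρ : ℝ} (hρ : 0 ≤ ρ) :
    volume {w : ℝ × ℝ | w.1 ^ 2 + w.2 ^ 2 < ρ ^ 2} = ENNReal.ofReal (Real.pi * ρ ^ 2) := by
  have hm : MeasurableSet {w : ℝ × ℝ | w.1 ^ 2 + w.2 ^ 2 < ρ ^ 2} :=
    measurableSet_lt (by fun_prop) (by fun_prop)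
  rw [← Complex.volume_preserving_equiv_real_prod.measure_preimage hm.nullMeasurableSet]
  have h : Complex.measurableEquivRealProd ⁻¹' {w : ℝ × ℝ | w.1 ^ 2 + w.2 ^ 2 < ρ ^ 2} =
      Metric.ball 0 ρ := by
    ext z
    simp only [mem_preimage, mem_ofPred_eq, Complex.measurableEquivRealProd_apply, mem_ball_zero_iff]
    rw [← sq_lt_sq₀ (norm_nonneg z) hρ, ← Complex.normSq_eq_norm_sq, Complex.normSq_apply]
    ring_nf
  rw [h, Complex.volume_ball, ← ENNReal.ofReal_pow hρ, mul_comm, ← NNReal.coe_real_pi,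
    ENNReal.ofReal_mul (by positivity), ENNReal.ofReal_coe_nnreal]

lemma volume_annulus {ρ T : ℝ} (hρ : 0 ≤ ρ) (hT : ρ ≤ T) :
    volume {w : ℝ × ℝ | ρ ^ 2 ≤ w.1 ^ 2 + w.2 ^ 2 ∧ w.1 ^ 2 + w.2 ^ 2 < T ^ 2} =
      ENNReal.ofReal (Real.pi * (T ^ 2 - ρ ^ 2)) := by
  have hm : MeasurableSet {w : ℝ × ℝ | w.1 ^ 2 + w.2 ^ 2 < ρ ^ 2} :=
    measurableSet_lt (by fun_prop) (by fun_prop)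
  have h : {w : ℝ × ℝ | ρ ^ 2 ≤ w.1 ^ 2 + w.2 ^ 2 ∧ w.1 ^ 2 + w.2 ^ 2 < T ^ 2} =
      {w : ℝ × ℝ | w.1 ^ 2 + w.2 ^ 2 < T ^ 2} \ {w : ℝ × ℝ | w.1 ^ 2 + w.2 ^ 2 < ρ ^ 2} := by
    ext w
    simp only [mem_ofPred_eq, mem_sdiff, not_lt]
    exact and_comm
  have hsub : {w : ℝ × ℝ | w.1 ^ 2 + w.2 ^ 2 < ρ ^ 2} ⊆ {w : ℝ × ℝ | w.1 ^ 2 + w.2 ^ 2 < T ^ 2} :=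
    fun w hw =>
    lt_of_lt_of_le (show w.1 ^ 2 + w.2 ^ 2 < ρ ^ 2 from hw) (by nlinarith)
  rw [h, measure_sdiff hsub hm.nullMeasurableSet (by rw [volume_disc hρ]; exact ENNReal.ofReal_ne_top),
    volume_disc hρ, volume_disc (hρ.trans hT), ← ENNReal.ofReal_sub _ (by positivity)]
  congr 1
  ring

/-! ### Gnomonic coordinates and the area of pieces of caps. -/

/-- The gnomonic parametrisation of the hemisphere around `x`, before normalisation. -/
def gnomonic (x e₁ e₂ : E3) (w : ℝ × ℝ) : E3 :=
  x + w.1 • e₁ + w.2 • e₂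

lemma inner_eq_zero_or_one {a b c : E3} (h : Orthonormal ℝ ![a, b, c]) :
    inner ℝ a a = (1 : ℝ) ∧ inner ℝ b b = (1 : ℝ) ∧ inner ℝ c c = (1 : ℝ) ∧
      inner ℝ a b = (0 : ℝ) ∧ inner ℝ a c = (0 : ℝ) ∧ inner ℝ b c = (0 : ℝ) := by
  rw [orthonormal_iff_ite] at h
  exact ⟨by simpa using h 0 0, by simpa using h 1 1, by simpa using h 2 2, by simpa using h 0 1,
    by simpa using h 0 2, by simpa using h 1 2⟩

section Gnomonic

variable {x e₁ e₂ : E3}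

lemma inner_gnomonic (h : Orthonormal ℝ ![x, e₁, e₂]) (w : ℝ × ℝ) :
    inner ℝ (gnomonic x e₁ e₂ w) x = (1 : ℝ) ∧ inner ℝ (gnomonic x e₁ e₂ w) e₁ = w.1 ∧
      inner ℝ (gnomonic x e₁ e₂ w) e₂ = w.2 := by
  obtain ⟨h1, h2, h3, h4, h5, h6⟩ := inner_eq_zero_or_one h
  have h4' := real_inner_comm x e₁ ▸ h4
  have h5' := real_inner_comm x e₂ ▸ h5
  have h6' := real_inner_comm e₁ e₂ ▸ h6
  simp only [gnomonic, inner_add_left, inner_smul_left, conj_trivial, h1, h2, h3, h4, h5, h6, h4',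
    h5', h6']
  simp

lemma norm_gnomonic (h : Orthonormal ℝ ![x, e₁, e₂]) (w : ℝ × ℝ) :
    ‖gnomonic x e₁ e₂ w‖ = √(1 + w.1 ^ 2 + w.2 ^ 2) := by
  obtain ⟨h1, h2, h3⟩ := inner_gnomonic h w
  have : ‖gnomonic x e₁ e₂ w‖ ^ 2 = 1 + w.1 ^ 2 + w.2 ^ 2 := by
    rw [← real_inner_self_eq_norm_sq]
    conv_lhs => rw [show inner ℝ (gnomonic x e₁ e₂ w) (gnomonic x e₁ e₂ w) =
      inner ℝ (gnomonic x e₁ e₂ w) (x + w.1 • e₁ + w.2 • e₂) from rfl]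
    rw [inner_add_right, inner_add_right, inner_smul_right, inner_smul_right, h1, h2, h3]
    ring
  rw [← this, Real.sqrt_sq (norm_nonneg _)]

lemma gnomonic_ne_zero (h : Orthonormal ℝ ![x, e₁, e₂]) (w : ℝ × ℝ) :
    gnomonic x e₁ e₂ w ≠ 0 := by
  rw [← norm_pos_iff, norm_gnomonic h]
  positivity

/-- The gnomonic parametrisation of the hemisphere around `x`. -/
def gnomonicPoint (h : Orthonormal ℝ ![x, e₁, e₂]) (w : ℝ × ℝ) : S2 :=
  ⟨‖gnomonic x e₁ e₂ w‖⁻¹ • gnomonic x e₁ e₂ w, by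
    rw [mem_sphere_zero_iff_norm, norm_smul, norm_inv, norm_norm,
      inv_mul_cancel₀ (norm_ne_zero_iff.2 (gnomonic_ne_zero h w))]⟩

lemma gnomonic_eq (h : Orthonormal ℝ ![x, e₁, e₂]) (w : ℝ × ℝ) :
    gnomonic x e₁ e₂ w = ‖gnomonic x e₁ e₂ w‖ • (gnomonicPoint h w : E3) := by
  rw [gnomonicPoint, smul_smul, mul_inv_cancel₀ (norm_ne_zero_iff.2 (gnomonic_ne_zero h w)),
    one_smul]

lemma continuous_gnomonicPoint (h : Orthonormal ℝ ![x, e₁, e₂]) :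
    Continuous (gnomonicPoint h) := by
  have hc : Continuous (gnomonic x e₁ e₂) := by unfold gnomonic; fun_prop
  exact (((hc.norm.inv₀ fun w => norm_ne_zero_iff.2 (gnomonic_ne_zero h w)).smul hc)).subtype_mk _

lemma gnomonicPoint_injective (h : Orthonormal ℝ ![x, e₁, e₂]) :
    Function.Injective (gnomonicPoint h) := by
  intro w w' hw
  obtain ⟨h1, h2, h3⟩ := inner_gnomonic h w
  obtain ⟨h1', h2', h3'⟩ := inner_gnomonic h w'
  rw [gnomonic_eq h w, inner_smul_left] at h1 h2 h3
  rw [gnomonic_eq h w', inner_smul_left] at h1' h2' h3'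
  simp only [conj_trivial] at h1 h2 h3 h1' h2' h3'
  rw [hw] at h1 h2 h3
  have hne : inner ℝ (gnomonicPoint h w' : E3) x ≠ 0 := by
    intro h0
    rw [h0] at h1
    simp at h1
  have hn : ‖gnomonic x e₁ e₂ w‖ = ‖gnomonic x e₁ e₂ w'‖ :=
    mul_right_cancel₀ hne (h1.trans h1'.symm)
  exact Prod.ext (by rw [← h2, ← h2', hn]) (by rw [← h3, ← h3', hn])

/-- The surface is the affine tangent plane, so the determinant is 1 and only the factor `‖P‖⁻³`
remains. -/
lemma sigma_gnomonicPoint_image (h : Orthonormal ℝ ![x, e₁, e₂]) {D : Set (ℝ × ℝ)}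
    (hD : MeasurableSet D) :
    sigma (gnomonicPoint h '' D) = ENNReal.ofReal (1 / (4 * Real.pi)) *
      ∫⁻ w in D, ENNReal.ofReal (1 / √(1 + w.1 ^ 2 + w.2 ^ 2) ^ 3) := by
  set P' : ℝ × ℝ →L[ℝ] E3 := (ContinuousLinearMap.fst ℝ ℝ ℝ).smulRight e₁ +
    (ContinuousLinearMap.snd ℝ ℝ ℝ).smulRight e₂ with hP'
  have hd : ∀ w, HasFDerivAt (gnomonic x e₁ e₂) P' w := by
    intro w
    have h0 : gnomonic x e₁ e₂ = fun w => x + P' w := by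
      ext w : 1
      simp [gnomonic, hP', add_assoc]
    rw [h0]
    exact P'.hasFDerivAt.const_add x
  rw [sigma_image hD hd (continuous_gnomonicPoint h) (gnomonic_eq h) (gnomonic_ne_zero h)
    (gnomonicPoint_injective h).injOn (J := fun _ => 1) measurable_const]
  · simp_rw [norm_gnomonic h]
  · intro w _
    have e1 : P' (1, 0) = e₁ := by simp [hP']
    have e2 : P' (0, 1) = e₂ := by simp [hP']
    rw [e1, e2]
    refine Eq.trans ?_ (abs_det3_of_orthonormal h)
    congr 1
    simp only [gnomonic, det3, Module.Basis.det_apply, Matrix.det_fin_three,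
      Module.Basis.toMatrix_apply]
    simp
    ring

lemma sigma_gnomonicPoint_image_le (h : Orthonormal ℝ ![x, e₁, e₂]) {D : Set (ℝ × ℝ)}
    (hD : MeasurableSet D) :
    sigma (gnomonicPoint h '' D) ≤ ENNReal.ofReal (1 / (4 * Real.pi)) * volume D := by
  rw [sigma_gnomonicPoint_image h hD, ← setLIntegral_one]
  gcongr with w
  rw [← ENNReal.ofReal_one]
  refine ENNReal.ofReal_le_ofReal ?_
  have h1 : 1 ≤ √(1 + w.1 ^ 2 + w.2 ^ 2) := Real.one_le_sqrt.2 (by nlinarith [sq_nonneg w.1, sq_nonneg w.2])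
  exact div_le_one_of_le₀ (one_le_pow₀ h1) (by positivity)

/-- With `q = w.1² + w.2²`, the density satisfies `(1 + q)^(-3/2) ≥ 1 - 3q/2`. -/
lemma le_sigma_gnomonicPoint_image (h : Orthonormal ℝ ![x, e₁, e₂]) {D : Set (ℝ × ℝ)}
    (hD : MeasurableSet D) {ρ : ℝ} (hDρ : ∀ w ∈ D, w.1 ^ 2 + w.2 ^ 2 < ρ ^ 2) :
    ENNReal.ofReal (1 / (4 * Real.pi)) * (ENNReal.ofReal (1 - 3 * ρ ^ 2 / 2) * volume D) ≤
      sigma (gnomonicPoint h '' D) := by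
  rw [sigma_gnomonicPoint_image h hD, ← setLIntegral_const]
  gcongr ENNReal.ofReal (1 / (4 * Real.pi)) * ?_
  refine setLIntegral_mono' hD fun w hw => ENNReal.ofReal_le_ofReal ?_
  set q := w.1 ^ 2 + w.2 ^ 2 with hq
  have hq0 : 0 ≤ q := by positivity
  have h1 : √(1 + w.1 ^ 2 + w.2 ^ 2) ≤ 1 + q / 2 := by
    rw [Real.sqrt_le_iff]
    exact ⟨by positivity, by nlinarith⟩
  have h2 : 0 < √(1 + w.1 ^ 2 + w.2 ^ 2) := by positivity
  rw [le_div_iff₀ (by positivity)]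
  have h3 : √(1 + w.1 ^ 2 + w.2 ^ 2) ^ 3 ≤ (1 + q / 2) ^ 3 := by gcongr
  have h4 := hDρ w hw
  by_cases hneg : 1 - 3 * ρ ^ 2 / 2 ≤ 0
  · exact (mul_nonpos_of_nonpos_of_nonneg hneg (by positivity)).trans zero_le_one
  · have h5 : (1 - 3 * ρ ^ 2 / 2) ≤ 1 - 3 * q / 2 := by linarith
    calc (1 - 3 * ρ ^ 2 / 2) * √(1 + w.1 ^ 2 + w.2 ^ 2) ^ 3
        ≤ (1 - 3 * q / 2) * (1 + q / 2) ^ 3 := by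
          push Not at hneg
          gcongr
          linarith
      _ ≤ 1 := by nlinarith [mul_nonneg hq0 hq0, mul_nonneg (mul_nonneg hq0 hq0) hq0,
          mul_nonneg (mul_nonneg hq0 hq0) (mul_nonneg hq0 hq0)]

end Gnomonic

lemma mem_cap_iff {x y : S2} {ρ : ℝ} (h0 : 0 ≤ ρ) (hπ : ρ ≤ Real.pi) :
    y ∈ cap x ρ ↔ Real.cos ρ < inner ℝ (x : E3) (y : E3) := by
  have hx : ‖(x : E3)‖ = 1 := mem_sphere_zero_iff_norm.1 x.2
  have hy : ‖(y : E3)‖ = 1 := mem_sphere_zero_iff_norm.1 y.2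
  have h : inner ℝ (x : E3) (y : E3) = Real.cos (geodesicDist x y) := by
    rw [geodesicDist, InnerProductGeometry.cos_angle, hx, hy]
    simp
  rw [h, cap, mem_ofPred_eq]
  exact (Real.strictAntiOn_cos.lt_iff_gt ⟨h0, hπ⟩
    ⟨InnerProductGeometry.angle_nonneg _ _, InnerProductGeometry.angle_le_pi _ _⟩).symm

section CapArea

variable {x : S2} {e₁ e₂ : E3}

/-- Central projection turns angular radius `ρ` into planar radius `tan ρ`; the disc of radius `ρ <
tan ρ` serves for the converse inclusion in `gnomonicPoint_mem_cap`. -/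
lemma cap_subset_gnomonicPoint_image (h : Orthonormal ℝ ![(x : E3), e₁, e₂]) {ρ : ℝ} (h0 : 0 < ρ)
    (hπ : ρ < Real.pi / 2) :
    cap x ρ ⊆ gnomonicPoint h '' {w | w.1 ^ 2 + w.2 ^ 2 < Real.tan ρ ^ 2} := by
  intro y hy
  rw [mem_cap_iff h0.le (by linarith [Real.pi_pos])] at hy
  have hc : 0 < Real.cos ρ := Real.cos_pos_of_mem_Ioo ⟨by linarith, hπ⟩
  set c := inner ℝ (x : E3) (y : E3) with hcdef
  have hc0 : 0 < c := hc.trans hy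
  have hdec := orthonormal_decomposition h (y : E3)
  have hny : ‖(y : E3)‖ = 1 := mem_sphere_zero_iff_norm.1 y.2
  set w : ℝ × ℝ := (inner ℝ e₁ (y : E3) / c, inner ℝ e₂ (y : E3) / c) with hw
  have hg : c • gnomonic x e₁ e₂ w = (y : E3) := by
    conv_rhs => rw [hdec]
    simp only [gnomonic, smul_add, smul_smul, hw, mul_div_cancel₀ _ hc0.ne', ← hcdef]
  have hn : c * ‖gnomonic x e₁ e₂ w‖ = 1 := by
    have h1 := congrArg norm hg
    rwa [hny, norm_smul, Real.norm_of_nonneg hc0.le] at h1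
  refine ⟨w, ?_, ?_⟩
  · rw [norm_gnomonic h] at hn
    have h1 : c ^ 2 * (1 + w.1 ^ 2 + w.2 ^ 2) = 1 := by
      rw [← Real.sq_sqrt (show 0 ≤ 1 + w.1 ^ 2 + w.2 ^ 2 by positivity), ← mul_pow, hn, one_pow]
    have h3 : (1 + Real.tan ρ ^ 2) * Real.cos ρ ^ 2 = 1 := by
      rw [Real.tan_eq_sin_div_cos]
      field_simp
      linarith [Real.sin_sq_add_cos_sq ρ]
    have h4 : Real.cos ρ ^ 2 < c ^ 2 := by gcongr
    rw [mem_ofPred_eq]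
    by_contra hcon
    push Not at hcon
    nlinarith [sq_nonneg (Real.tan ρ), sq_pos_of_pos hc]
  · apply Subtype.ext
    rw [← hg]
    exact congrArg (fun l : ℝ => l • gnomonic (x : E3) e₁ e₂ w) (inv_eq_of_mul_eq_one_left hn)

lemma gnomonicPoint_mem_cap (h : Orthonormal ℝ ![(x : E3), e₁, e₂]) {ρ : ℝ} (h0 : 0 < ρ)
    (hπ : ρ < Real.pi / 2) {w : ℝ × ℝ} (hw : w.1 ^ 2 + w.2 ^ 2 < ρ ^ 2) :
    gnomonicPoint h w ∈ cap x ρ := by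
  rw [mem_cap_iff h0.le (by linarith [Real.pi_pos])]
  have hc : 0 < Real.cos ρ := Real.cos_pos_of_mem_Ioo ⟨by linarith, hπ⟩
  rw [real_inner_comm, gnomonicPoint, inner_smul_left, (inner_gnomonic h w).1, norm_gnomonic h]
  simp only [conj_trivial, mul_one]
  rw [lt_inv_comm₀ hc (by positivity), Real.sqrt_lt' (by positivity)]
  have ht : ρ < Real.tan ρ := Real.lt_tan h0 hπ
  have h3 : (Real.cos ρ)⁻¹ ^ 2 = 1 + Real.tan ρ ^ 2 := by
    rw [Real.tan_eq_sin_div_cos]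
    field_simp
    linarith [Real.sin_sq_add_cos_sq ρ]
  rw [h3]
  nlinarith

lemma measurableSet_discPart (ρ s : ℝ) : MeasurableSet (discPart ρ s) :=
  (measurableSet_lt measurable_const measurable_fst).inter
    (measurableSet_lt (f := fun w : ℝ × ℝ => w.1 ^ 2 + w.2 ^ 2) (by fun_prop) measurable_const)

/-- Upper bound for the area of a part of a cap that is essentially cut off by a line in gnomonic
coordinates. -/
lemma sigma_cap_inter_le (h : Orthonormal ℝ ![(x : E3), e₁, e₂]) {ρ s δ : ℝ} (h0 : 0 < ρ)
    (hπ : ρ < Real.pi / 2) (hs0 : 0 ≤ s) (hs : s ≤ ρ) (hδ : 0 ≤ δ) {B : Set S2}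
    (hB : ∀ w : ℝ × ℝ, w.1 ^ 2 + w.2 ^ 2 < Real.tan ρ ^ 2 → w.1 ≤ s - δ → gnomonicPoint h w ∉ B) :
    sigma (cap x ρ ∩ B) ≤ ENNReal.ofReal (1 / (4 * Real.pi) *
      (discPartArea ρ s + Real.pi * (Real.tan ρ ^ 2 - ρ ^ 2) + 2 * δ * Real.tan ρ)) := by
  have ht : ρ < Real.tan ρ := Real.lt_tan h0 hπ
  set T := Real.tan ρ with hT
  -- The cover consists of the ideal segment, the annulus between radii `ρ` and `tan ρ`, and the
  -- strip where membership in `B` is undecided.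
  set D : Set (ℝ × ℝ) := (discPart ρ s ∪
    {w : ℝ × ℝ | ρ ^ 2 ≤ w.1 ^ 2 + w.2 ^ 2 ∧ w.1 ^ 2 + w.2 ^ 2 < T ^ 2}) ∪
      Icc (s - δ) s ×ˢ Icc (-T) T with hD
  have hDm : MeasurableSet D := by
    refine ((measurableSet_discPart ρ s).union ?_).union (measurableSet_Icc.prod measurableSet_Icc)
    have hm : Measurable fun w : ℝ × ℝ => w.1 ^ 2 + w.2 ^ 2 := by fun_prop
    exact (measurableSet_le measurable_const hm).inter (measurableSet_lt hm measurable_const)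
  have hsub : cap x ρ ∩ B ⊆ gnomonicPoint h '' D := by
    rintro y ⟨hy, hyB⟩
    obtain ⟨w, hw, rfl⟩ := cap_subset_gnomonicPoint_image h h0 hπ hy
    refine ⟨w, ?_, rfl⟩
    rw [mem_ofPred_eq] at hw
    by_cases h1 : ρ ^ 2 ≤ w.1 ^ 2 + w.2 ^ 2
    · exact Or.inl (Or.inr ⟨h1, hw⟩)
    by_cases h2 : s < w.1
    · exact Or.inl (Or.inl ⟨h2, not_le.1 h1⟩)
    · refine Or.inr ⟨⟨?_, not_lt.1 h2⟩, abs_le.1 ?_⟩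
      · by_contra hcon
        exact hB w hw (not_le.1 hcon).le hyB
      · exact abs_le_of_sq_le_sq (by nlinarith [sq_nonneg w.1]) (by linarith)
  have hvol : volume D ≤ ENNReal.ofReal
      (discPartArea ρ s + Real.pi * (T ^ 2 - ρ ^ 2) + 2 * δ * T) := by
    have hA := discPartArea_nonneg hs
    have hp : 0 ≤ Real.pi * (T ^ 2 - ρ ^ 2) := mul_nonneg Real.pi_pos.le (by nlinarith)
    have hdT : 0 ≤ 2 * δ * T := by have : 0 < T := h0.trans ht; positivity
    rw [ENNReal.ofReal_add (by linarith) hdT, ENNReal.ofReal_add hA hp]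
    refine (measure_union_le _ _).trans (add_le_add ((measure_union_le _ _).trans
      (add_le_add (volume_discPart (by linarith) hs).le (volume_annulus h0.le ht.le).le)) ?_)
    rw [Measure.volume_eq_prod, Measure.prod_prod, Real.volume_Icc, Real.volume_Icc,
      ← ENNReal.ofReal_mul (by linarith)]
    refine ENNReal.ofReal_le_ofReal (le_of_eq ?_)
    ring
  refine (measure_mono hsub).trans ((sigma_gnomonicPoint_image_le h hDm).trans ?_)
  rw [ENNReal.ofReal_mul (by positivity)]
  gcongr

/-- Lower bound for the area of a part of a cap that is essentially cut off by a line in gnomonic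
coordinates. -/
lemma le_sigma_cap_inter (h : Orthonormal ℝ ![(x : E3), e₁, e₂]) {ρ s δ : ℝ} (h0 : 0 < ρ)
    (hπ : ρ < Real.pi / 2) (hs0 : 0 ≤ s) (hs : s ≤ ρ) (hδ : 0 ≤ δ) {B : Set S2}
    (hB : ∀ w : ℝ × ℝ, w.1 ^ 2 + w.2 ^ 2 < ρ ^ 2 → s + δ < w.1 → gnomonicPoint h w ∈ B) :
    ENNReal.ofReal (1 / (4 * Real.pi) *
      (discPartArea ρ s - 2 * δ * ρ - 3 * ρ ^ 4)) ≤ sigma (cap x ρ ∩ B) := by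
  set D : Set (ℝ × ℝ) := discPart ρ s \ (Icc s (s + δ) ×ˢ Icc (-ρ) ρ) with hD
  have hDm : MeasurableSet D :=
    (measurableSet_discPart ρ s).diff (measurableSet_Icc.prod measurableSet_Icc)
  have hsub : gnomonicPoint h '' D ⊆ cap x ρ ∩ B := by
    rintro _ ⟨w, ⟨hw, hw'⟩, rfl⟩
    refine ⟨gnomonicPoint_mem_cap h h0 hπ hw.2, hB w hw.2 ?_⟩
    by_contra hcon
    refine hw' ⟨⟨hw.1.le, not_lt.1 hcon⟩, abs_le.1 ?_⟩
    exact abs_le_of_sq_le_sq (by nlinarith [sq_nonneg w.1, hw.2]) h0.le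
  have hvol : ENNReal.ofReal (discPartArea ρ s - 2 * δ * ρ) ≤ volume D := by
    rw [ENNReal.ofReal_sub _ (by positivity), ← volume_discPart (by linarith) hs]
    refine le_trans (tsub_le_tsub_left ?_ _) le_measure_sdiff
    rw [Measure.volume_eq_prod, Measure.prod_prod, Real.volume_Icc, Real.volume_Icc,
      ← ENNReal.ofReal_mul (by linarith)]
    refine ENNReal.ofReal_le_ofReal (le_of_eq ?_)
    ring
  refine le_trans ?_ ((le_sigma_gnomonicPoint_image h hDm fun w hw => hw.1.2).trans
    (measure_mono hsub))
  rw [ENNReal.ofReal_mul (by positivity)]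
  gcongr ENNReal.ofReal (1 / (4 * Real.pi)) * ?_
  have hA := discPartArea_le h0.le hs0 hs
  have hδρ : 0 ≤ 2 * δ * ρ := by positivity
  -- The density loses at most `(3ρ²/2) · 2ρ² = 3ρ⁴`. In the nontrivial case `3ρ⁴ < 2ρ²`, which
  -- makes `1 - 3ρ²/2` nonnegative.
  by_cases hneg : discPartArea ρ s - 2 * δ * ρ - 3 * ρ ^ 4 ≤ 0
  · rw [ENNReal.ofReal_of_nonpos hneg]
    exact zero_le
  · push Not at hneg
    have h4 : 0 < ρ ^ 4 := by positivity
    have h1 : 0 ≤ 1 - 3 * ρ ^ 2 / 2 := by nlinarith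
    refine le_trans ?_ (mul_le_mul_right hvol _)
    rw [← ENNReal.ofReal_mul h1]
    refine ENNReal.ofReal_le_ofReal ?_
    nlinarith [mul_nonneg (sq_nonneg ρ) hδρ, mul_le_mul_of_nonneg_left hA (sq_nonneg ρ)]

end CapArea

/-! ### Normal frames along the curve. -/

lemma inner_coe_self (x : S2) : inner ℝ (x : E3) (x : E3) = (1 : ℝ) := by
  rw [real_inner_self_eq_norm_sq, mem_sphere_zero_iff_norm.1 x.2, one_pow]

/-- A unit normal field `n` along the curve `γ`, tangent to the sphere, with geodesic
curvature `k`. -/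
structure IsNormalFrame (γ : ℝ → S2) (n : ℝ → E3) (k : ℝ → ℝ) : Prop where
  curve : IsSmoothSimpleClosedCurve γ
  inner_self : ∀ t, inner ℝ (n t) (n t) = (1 : ℝ)
  inner_curve : ∀ t, inner ℝ (n t) (γ t : E3) = (0 : ℝ)
  inner_velocity : ∀ t, inner ℝ (n t) (velocity γ t) = (0 : ℝ)
  hasDerivAt : ∀ t, HasDerivAt n (-(k t) • velocity γ t) t
  measurable : Measurable k

namespace IsSmoothSimpleClosedCurve

variable {γ : ℝ → S2} (hγ : IsSmoothSimpleClosedCurve γ)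
include hγ

lemma hasDerivAt (t : ℝ) : HasDerivAt (fun s => (γ s : E3)) (velocity γ t) t :=
  (hγ.smooth.differentiable (by simp) t).hasDerivAt

lemma contDiff_velocity : ContDiff ℝ (⊤ : ℕ∞) (velocity γ) := by
  have h : ContDiff ℝ ((⊤ : ℕ∞) + 1) (fun s => (γ s : E3)) := hγ.smooth
  exact (contDiff_succ_iff_deriv.1 h).2.2

lemma hasDerivAt_velocity (t : ℝ) : HasDerivAt (velocity γ) (deriv (velocity γ) t) t :=
  (hγ.contDiff_velocity.differentiable (by simp) t).hasDerivAt

lemma inner_velocity (t : ℝ) : inner ℝ (velocity γ t) (γ t : E3) = (0 : ℝ) := by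
  have h1 := (hγ.hasDerivAt t).inner ℝ (hγ.hasDerivAt t)
  have h2 : (fun t => inner ℝ (γ t : E3) (γ t : E3)) = fun _ => (1 : ℝ) :=
    funext fun t => inner_coe_self _
  rw [h2] at h1
  have h3 := h1.unique (hasDerivAt_const t (1 : ℝ))
  rw [real_inner_comm (velocity γ t)] at h3
  linarith

lemma inner_deriv_velocity (t : ℝ) :
    inner ℝ (deriv (velocity γ) t) (γ t : E3) = -‖velocity γ t‖ ^ 2 := by
  have h1 := (hγ.hasDerivAt_velocity t).inner ℝ (hγ.hasDerivAt t)
  rw [funext hγ.inner_velocity] at h1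
  have h3 := h1.unique (hasDerivAt_const t (0 : ℝ))
  rw [real_inner_self_eq_norm_sq] at h3
  linarith

end IsSmoothSimpleClosedCurve

/-- The cross product on Euclidean three-space. -/
def cross (a b : E3) : E3 :=
  !₂[a 1 * b 2 - a 2 * b 1, a 2 * b 0 - a 0 * b 2, a 0 * b 1 - a 1 * b 0]

lemma inner_cross_left (a b : E3) : inner ℝ (cross a b) a = (0 : ℝ) := by
  simp [cross, PiLp.inner_apply, Fin.sum_univ_three]
  ring

lemma inner_cross_right (a b : E3) : inner ℝ (cross a b) b = (0 : ℝ) := by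
  simp [cross, PiLp.inner_apply, Fin.sum_univ_three]
  ring

lemma inner_cross_self (a b : E3) : inner ℝ (cross a b) (cross a b) =
    (inner ℝ a a * inner ℝ b b - inner ℝ a b ^ 2 : ℝ) := by
  simp only [cross, PiLp.inner_apply, Fin.sum_univ_three]
  simp
  ring

lemma contDiff_cross {f g : ℝ → E3} (hf : ContDiff ℝ (⊤ : ℕ∞) f) (hg : ContDiff ℝ (⊤ : ℕ∞) g) :
    ContDiff ℝ (⊤ : ℕ∞) fun t => cross (f t) (g t) := by
  have hf' : ∀ i, ContDiff ℝ (⊤ : ℕ∞) fun t => f t i := contDiff_euclidean.1 hf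
  have hg' : ∀ i, ContDiff ℝ (⊤ : ℕ∞) fun t => g t i := contDiff_euclidean.1 hg
  refine contDiff_euclidean.2 fun i => ?_
  fin_cases i
  · exact ((hf' 1).mul (hg' 2)).sub ((hf' 2).mul (hg' 1))
  · exact ((hf' 2).mul (hg' 0)).sub ((hf' 0).mul (hg' 2))
  · exact ((hf' 0).mul (hg' 1)).sub ((hf' 1).mul (hg' 0))

/-- Vectors tangent to the sphere at `p` and orthogonal to the tangent vector `v` form a line. -/
lemma orthonormal_frame {p n v : E3} (hp : inner ℝ p p = (1 : ℝ)) (hn : inner ℝ n n = (1 : ℝ))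
    (hv : v ≠ 0) (hnp : inner ℝ n p = (0 : ℝ)) (hnv : inner ℝ n v = (0 : ℝ))
    (hvp : inner ℝ v p = (0 : ℝ)) : Orthonormal ℝ ![p, n, ‖v‖⁻¹ • v] := by
  have h0 : ‖v‖ ≠ 0 := norm_ne_zero_iff.2 hv
  refine orthonormal_triple hp hn ?_ ?_ ?_ ?_
  · rw [inner_smul_left, inner_smul_right, real_inner_self_eq_norm_sq]
    simp only [conj_trivial]
    field_simp
  · rw [real_inner_comm, hnp]
  · rw [inner_smul_right, real_inner_comm, hvp, mul_zero]
  · rw [inner_smul_right, hnv, mul_zero]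

theorem exists_isNormalFrame {γ : ℝ → S2} (hγ : IsSmoothSimpleClosedCurve γ) :
    ∃ n k, IsNormalFrame γ n k := by
  set n : ℝ → E3 := fun t => ‖velocity γ t‖⁻¹ • cross (γ t) (velocity γ t) with hn
  have hv0 : ∀ t, ‖velocity γ t‖ ≠ 0 := fun t => norm_ne_zero_iff.2 (hγ.regular t)
  have hsm : ContDiff ℝ (⊤ : ℕ∞) n :=
    ((hγ.contDiff_velocity.norm ℝ hγ.regular).inv hv0).smul
      (contDiff_cross hγ.smooth hγ.contDiff_velocity)
  have hd : ∀ t, HasDerivAt n (deriv n t) t := fun t =>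
    (hsm.differentiable (by simp) t).hasDerivAt
  have h1 : ∀ t, inner ℝ (n t) (n t) = (1 : ℝ) := by
    intro t
    simp only [hn, inner_smul_left, inner_smul_right, inner_cross_self, inner_coe_self,
      conj_trivial, real_inner_self_eq_norm_sq (velocity γ t)]
    rw [real_inner_comm, hγ.inner_velocity]
    have := hv0 t
    field_simp
    ring
  have h2 : ∀ t, inner ℝ (n t) (γ t : E3) = (0 : ℝ) := fun t => by
    simp only [hn, inner_smul_left, inner_cross_left, mul_zero]
  have h3 : ∀ t, inner ℝ (n t) (velocity γ t) = (0 : ℝ) := fun t => by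
    simp only [hn, inner_smul_left, inner_cross_right, mul_zero]
  refine ⟨n, fun t => -(inner ℝ (velocity γ t) (deriv n t) / ‖velocity γ t‖ ^ 2),
    hγ, h1, h2, h3, fun t => ?_, ?_⟩
  -- Differentiating `⟨n, γ⟩ = 0` and `⟨n, n⟩ = 1` shows that `n'` is orthogonal to `γ` and to `n`,
  -- hence a multiple of the velocity.
  · have hdec := orthonormal_decomposition (orthonormal_frame (inner_coe_self (γ t)) (h1 t)
      (hγ.regular t) (h2 t) (h3 t) (hγ.inner_velocity t)) (deriv n t)
    have e1 : inner ℝ (γ t : E3) (deriv n t) = (0 : ℝ) := by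
      have h := (hd t).inner ℝ (hγ.hasDerivAt t)
      rw [funext h2] at h
      have h' := h.unique (hasDerivAt_const t (0 : ℝ))
      rw [h3, zero_add, real_inner_comm] at h'
      exact h'
    have e2 : inner ℝ (n t) (deriv n t) = (0 : ℝ) := by
      have h := (hd t).inner ℝ (hd t)
      rw [funext h1] at h
      have h' := h.unique (hasDerivAt_const t (1 : ℝ))
      rw [real_inner_comm (n t)] at h'
      linarith
    rw [e1, e2, zero_smul, zero_smul, zero_add, zero_add, inner_smul_left, smul_smul] at hdec
    refine (hd t).congr_deriv (hdec.trans ?_)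
    congr 1
    simp only [conj_trivial, neg_neg]
    have := hv0 t
    field_simp
  · have hvm : Measurable (velocity γ) := hγ.contDiff_velocity.continuous.measurable
    exact ((hvm.inner (hsm.continuous_deriv (by simp)).measurable).div (hvm.norm.pow_const 2)).neg

/-! ### Connectedness of caps and of the sphere. -/

lemma isPreconnected_cap {x : S2} {ρ : ℝ} (h0 : 0 < ρ) (hπ : ρ < Real.pi / 2) :
    IsPreconnected (cap x ρ) := by
  have hc : 0 < Real.cos ρ := Real.cos_pos_of_mem_Ioo ⟨by linarith, hπ⟩
  -- The cap is the radial projection of the cone `K`, which is convex because `cos ρ > 0`.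
  set K : Set E3 := {v | Real.cos ρ * ‖v‖ < inner ℝ (x : E3) v} with hK
  have hconv : Convex ℝ K := by
    intro v hv u hu a b ha hb hab
    simp only [hK, mem_ofPred_eq] at hv hu ⊢
    have h1 : ‖a • v + b • u‖ ≤ a * ‖v‖ + b * ‖u‖ := by
      refine (norm_add_le _ _).trans ?_
      rw [norm_smul, norm_smul, Real.norm_of_nonneg ha, Real.norm_of_nonneg hb]
    rw [inner_add_right, inner_smul_right, inner_smul_right]
    have h2 := mul_le_mul_of_nonneg_left h1 hc.le
    rcases ha.eq_or_lt with rfl | ha'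
    · have : b = 1 := by linarith
      subst this
      simp only [zero_mul, zero_add, one_mul] at h2 ⊢
      linarith
    · nlinarith [mul_lt_mul_of_pos_left hv ha', mul_le_mul_of_nonneg_left hu.le hb]
  have hne : ∀ v ∈ K, ‖v‖ ≠ 0 := by
    intro v hv h
    rw [norm_eq_zero] at h
    simp [hK, h] at hv
  have himg : ((↑) : S2 → E3) '' cap x ρ = (fun v : E3 => ‖v‖⁻¹ • v) '' K := by
    ext y
    constructor
    · rintro ⟨y, hy, rfl⟩
      rw [mem_cap_iff h0.le (by linarith [Real.pi_pos])] at hy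
      have hy1 : ‖(y : E3)‖ = 1 := mem_sphere_zero_iff_norm.1 y.2
      refine ⟨y, ?_, ?_⟩
      · simpa only [hK, mem_ofPred_eq, hy1, mul_one] using hy
      · simp only [hy1, inv_one, one_smul]
    · rintro ⟨v, hv, rfl⟩
      have hv0 := hne v hv
      refine ⟨⟨‖v‖⁻¹ • v, ?_⟩, ?_, rfl⟩
      · rw [mem_sphere_zero_iff_norm, norm_smul, norm_inv, norm_norm, inv_mul_cancel₀ hv0]
      · rw [mem_cap_iff h0.le (by linarith [Real.pi_pos]), inner_smul_right]
        have hpos : 0 < ‖v‖ := lt_of_le_of_ne (norm_nonneg v) hv0.symm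
        rw [inv_mul_eq_div, lt_div_iff₀ hpos]
        exact hv
  rw [← Topology.IsInducing.subtypeVal.isPreconnected_image, himg]
  refine hconv.isPreconnected.image _ ?_
  exact (continuous_norm.continuousOn.inv₀ hne).smul continuousOn_id

lemma preconnectedSpace_S2 : PreconnectedSpace S2 := by
  refine Subtype.preconnectedSpace (isPreconnected_sphere ?_ _ _)
  rw [← Module.finrank_eq_rank, finrank_euclideanSpace_fin]
  norm_num

lemma subset_interior_or_of_disjoint_frontier {X : Type*} [TopologicalSpace X] {A U : Set X}
    (hU : IsPreconnected U) (h : Disjoint U (frontier A)) :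
    U ⊆ interior A ∨ U ⊆ interior Aᶜ := by
  refine hU.subset_or_subset isOpen_interior isOpen_interior
    (disjoint_compl_right.mono interior_subset interior_subset) fun x hx => ?_
  have h1 : x ∉ frontier A := fun hf => h.ne_of_mem hx hf rfl
  by_cases hA : x ∈ closure A
  · left
    by_contra hi
    exact h1 ⟨hA, hi⟩
  · right
    rwa [interior_compl]

/-! ### Tube coordinates, nearest points and the curvature bound. -/

namespace IsNormalFrame

variable {γ : ℝ → S2} {n : ℝ → E3} {k : ℝ → ℝ}

/-- Reversing the normal lets one argument treat either side of the curve. -/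
lemma neg (h : IsNormalFrame γ n k) : IsNormalFrame γ (-n) (-k) where
  curve := h.curve
  inner_self t := by simpa using h.inner_self t
  inner_curve t := by simpa using h.inner_curve t
  inner_velocity t := by simpa using h.inner_velocity t
  hasDerivAt t := by simpa using (h.hasDerivAt t).neg
  measurable := h.measurable.neg

lemma inner_tube (h : IsNormalFrame γ n k) (t s s' : ℝ) :
    inner ℝ (Real.cos s • (γ t : E3) + Real.sin s • n t)
      (Real.cos s' • (γ t : E3) + Real.sin s' • n t) = Real.cos (s - s') := by
  simp only [inner_add_left, inner_add_right, inner_smul_left, inner_smul_right, conj_trivial,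
    inner_coe_self, h.inner_self, h.inner_curve, real_inner_comm (n t)]
  rw [Real.cos_sub]
  ring

/-- The point at signed distance `s` from the curve on the orthogonal geodesic through `γ t`. -/
def tubePoint (h : IsNormalFrame γ n k) (w : ℝ × ℝ) : S2 :=
  ⟨Real.cos w.2 • (γ w.1 : E3) + Real.sin w.2 • n w.1, by
    rw [mem_sphere_zero_iff_norm, norm_eq_sqrt_real_inner, h.inner_tube, sub_self, Real.cos_zero,
      Real.sqrt_one]⟩

lemma coe_tubePoint (h : IsNormalFrame γ n k) (t s : ℝ) :
    (h.tubePoint (t, s) : E3) = Real.cos s • (γ t : E3) + Real.sin s • n t := rfl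

lemma tubePoint_zero (h : IsNormalFrame γ n k) (t : ℝ) : h.tubePoint (t, 0) = γ t :=
  Subtype.ext (by simp [coe_tubePoint])

lemma neg_tubePoint (h : IsNormalFrame γ n k) (t s : ℝ) :
    h.neg.tubePoint (t, s) = h.tubePoint (t, -s) :=
  Subtype.ext (by simp [coe_tubePoint])

lemma continuous_tubePoint (h : IsNormalFrame γ n k) : Continuous h.tubePoint := by
  have h1 : Continuous fun t => (γ t : E3) := h.curve.smooth.continuous
  have h2 : Continuous n := continuous_iff_continuousAt.2 fun t => (h.hasDerivAt t).continuousAt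
  exact (((Real.continuous_cos.comp continuous_snd).smul (h1.comp continuous_fst)).add
    ((Real.continuous_sin.comp continuous_snd).smul (h2.comp continuous_fst))).subtype_mk _

lemma inner_tubePoint_curve (h : IsNormalFrame γ n k) (t s : ℝ) :
    inner ℝ (h.tubePoint (t, s) : E3) (γ t : E3) = Real.cos s := by
  rw [coe_tubePoint, inner_add_left, inner_smul_left, inner_smul_left, inner_coe_self,
    h.inner_curve]
  simp

/-- Every point of the sphere lies on the orthogonal geodesic through its nearest point on the
curve. -/
lemma exists_eq_tubePoint (h : IsNormalFrame γ n k) (x : S2) :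
    ∃ t ∈ Ico (0 : ℝ) 1, ∃ s, |s| ≤ Real.pi ∧ x = h.tubePoint (t, s) ∧
      ∀ t', inner ℝ (x : E3) (γ t' : E3) ≤ Real.cos s := by
  set g : ℝ → ℝ := fun t => inner ℝ (x : E3) (γ t : E3) with hg
  have hgc : Continuous g := continuous_const.inner h.curve.smooth.continuous
  have hper : Function.Periodic g 1 := fun t => by simp only [hg, h.curve.periodic t]
  obtain ⟨t₀, -, hmax⟩ := isCompact_Icc.exists_isMaxOn (nonempty_Icc.2 (zero_le_one (α := ℝ)))
    hgc.continuousOn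
  obtain ⟨t, ht, hgt⟩ := hper.exists_mem_Ico₀ one_pos t₀
  have hle : ∀ t', g t' ≤ g t := by
    intro t'
    obtain ⟨u, hu, hgu⟩ := hper.exists_mem_Ico₀ one_pos t'
    rw [hgu, ← hgt]
    exact hmax (Ico_subset_Icc_self hu)
  have hd : HasDerivAt g (inner ℝ (x : E3) (velocity γ t)) t := by
    simpa using (hasDerivAt_const t (x : E3)).inner ℝ (h.curve.hasDerivAt t)
  -- At a nearest point the inner product with the curve is maximal, so `x` is orthogonal to the
  -- velocity and lies in the span of `γ t` and `n t`.
  have h0 : inner ℝ (x : E3) (velocity γ t) = (0 : ℝ) :=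
    (IsLocalMax.hasDerivAt_eq_zero (Filter.Eventually.of_forall hle) hd)
  have hdec := orthonormal_decomposition (orthonormal_frame (inner_coe_self (γ t))
    (h.inner_self t) (h.curve.regular t) (h.inner_curve t) (h.inner_velocity t)
    (h.curve.inner_velocity t)) (x : E3)
  rw [inner_smul_left, real_inner_comm (x : E3) (velocity γ t), h0, mul_zero, zero_smul,
    add_zero] at hdec
  set c : ℝ := inner ℝ (γ t : E3) (x : E3) with hc
  set d : ℝ := inner ℝ (n t) (x : E3) with hd'
  have hcd : c ^ 2 + d ^ 2 = 1 := by
    have h1 := inner_coe_self x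
    rw [hdec] at h1
    simp only [inner_add_left, inner_add_right, inner_smul_left, inner_smul_right, conj_trivial,
      inner_coe_self, h.inner_self, h.inner_curve, real_inner_comm (n t)] at h1
    linarith
  have hc1 : -1 ≤ c := by nlinarith [sq_nonneg d]
  have hc2 : c ≤ 1 := by nlinarith [sq_nonneg d]
  have hgt' : g t = c := real_inner_comm _ _
  have habs : |Real.arccos c| ≤ Real.pi := by
    rw [abs_of_nonneg (Real.arccos_nonneg c)]
    exact Real.arccos_le_pi c
  have hsin : Real.sin (Real.arccos c) = |d| := by
    rw [Real.sin_arccos, ← Real.sqrt_sq_eq_abs]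
    congr 1
    linarith
  rcases le_total 0 d with h1 | h1
  · refine ⟨t, ht, Real.arccos c, habs, ?_, fun t' => ?_⟩
    · apply Subtype.ext
      rw [coe_tubePoint, Real.cos_arccos hc1 hc2, hsin, abs_of_nonneg h1]
      exact hdec
    · rw [Real.cos_arccos hc1 hc2, ← hgt']
      exact hle t'
  · refine ⟨t, ht, -Real.arccos c, by rwa [abs_neg], ?_, fun t' => ?_⟩
    · apply Subtype.ext
      rw [coe_tubePoint, Real.cos_neg, Real.sin_neg, Real.cos_arccos hc1 hc2, hsin,
        abs_of_nonpos h1, neg_neg]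
      exact hdec
    · rw [Real.cos_neg, Real.cos_arccos hc1 hc2, ← hgt']
      exact hle t'

lemma norm_smul_normal (h : IsNormalFrame γ n k) (s t : ℝ) : ‖s • n t‖ = |s| := by
  have h1 : ‖n t‖ = 1 := by rw [norm_eq_sqrt_real_inner, h.inner_self, Real.sqrt_one]
  rw [norm_smul, h1, mul_one, Real.norm_eq_abs]

lemma geodesicEnd_normal (h : IsNormalFrame γ n k) (t s : ℝ) :
    geodesicEnd (γ t : E3) (s • n t) = (h.tubePoint (t, s) : E3) := by
  have h2 : Real.sinc |s| * s = Real.sin s := by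
    rcases abs_cases s with ⟨h1, -⟩ | ⟨h1, -⟩ <;> rw [h1]
    · rcases eq_or_ne s 0 with rfl | h0
      · simp
      · rw [Real.sinc_of_ne_zero h0, div_mul_cancel₀ _ h0]
    · rw [Real.sinc_neg]
      rcases eq_or_ne s 0 with rfl | h0
      · simp
      · rw [Real.sinc_of_ne_zero h0, div_mul_cancel₀ _ h0]
  rw [geodesicEnd, h.norm_smul_normal, Real.cos_abs, smul_smul, h2, coe_tubePoint]

variable {θ : ℝ}

/-- Uniqueness concerns geodesics, not parameters: `t = t'` cannot follow, since `γ` is periodic. -/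
lemma eq_of_tubePoint_eq (h : IsNormalFrame γ n k) (hθ : TubeNoOverlap γ θ) {t s t' s' : ℝ}
    (hs : |s| ≤ θ) (hs' : |s'| ≤ θ) (heq : h.tubePoint (t, s) = h.tubePoint (t', s')) :
    γ t = γ t' ∧ s • n t = s' • n t' := by
  have hmem : ∀ t s : ℝ, |s| ≤ θ → ((γ t : E3), s • n t) ∈ orthogonalGeodesics γ θ := by
    intro t s hs
    refine ⟨t, rfl, ?_, ?_, ?_⟩
    · rw [inner_smul_left, h.inner_curve, mul_zero]
    · rw [inner_smul_left, h.inner_velocity, mul_zero]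
    · rwa [h.norm_smul_normal]
  have h1 := (hθ (h.tubePoint (t, s)) ⟨_, hmem t s hs, h.geodesicEnd_normal t s⟩).unique
    ⟨hmem t s hs, h.geodesicEnd_normal t s⟩
    ⟨hmem t' s' hs', (h.geodesicEnd_normal t' s').trans (by rw [heq])⟩
  exact ⟨Subtype.ext (congrArg Prod.fst h1), congrArg Prod.snd h1⟩

lemma abs_eq_of_tubePoint_eq (h : IsNormalFrame γ n k) (hθ : TubeNoOverlap γ θ) {t s t' s' : ℝ}
    (hs : |s| ≤ θ) (hs' : |s'| ≤ θ) (heq : h.tubePoint (t, s) = h.tubePoint (t', s')) :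
    |s| = |s'| := by
  rw [← h.norm_smul_normal s t, (h.eq_of_tubePoint_eq hθ hs hs' heq).2, h.norm_smul_normal]

lemma injOn_tubePoint (h : IsNormalFrame γ n k) (hθ : TubeNoOverlap γ θ) :
    InjOn h.tubePoint (Ico 0 1 ×ˢ Icc (-θ) θ) := by
  rintro ⟨t, s⟩ ⟨ht, hs⟩ ⟨t', s'⟩ ⟨ht', hs'⟩ heq
  obtain ⟨h1, h2⟩ := h.eq_of_tubePoint_eq hθ (abs_le.2 hs) (abs_le.2 hs') heq
  obtain rfl : t = t' := h.curve.simple ht ht' h1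
  have hn : n t ≠ 0 := fun h0 => by simpa [h0] using h.inner_self t
  exact congrArg (Prod.mk t) (smul_left_injective ℝ hn h2)

/-- Within the tube the distance to the curve is realised by the orthogonal geodesic. -/
lemma inner_tubePoint_le (h : IsNormalFrame γ n k) (hθ : TubeNoOverlap γ θ)
    {s : ℝ} (hs : |s| ≤ θ) (t t' : ℝ) :
    inner ℝ (h.tubePoint (t, s) : E3) (γ t' : E3) ≤ Real.cos s := by
  obtain ⟨t₁, -, s₁, hs₁, heq, hle⟩ := h.exists_eq_tubePoint (h.tubePoint (t, s))
  have h1 := hle t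
  rw [h.inner_tubePoint_curve, ← Real.cos_abs s, ← Real.cos_abs s₁] at h1
  have h2 : |s₁| ≤ |s| := by
    by_contra hcon
    exact absurd h1 (not_le.2 (Real.cos_lt_cos_of_nonneg_of_le_pi (abs_nonneg _) hs₁
      (not_le.1 hcon)))
  have h3 := h.abs_eq_of_tubePoint_eq hθ hs (h2.trans hs) heq
  rw [← Real.cos_abs s, h3, Real.cos_abs]
  exact hle t'

lemma tubePoint_notMem_range (h : IsNormalFrame γ n k) (hθ : TubeNoOverlap γ θ)
    (hπ : θ ≤ Real.pi) {s : ℝ} (hs : |s| ≤ θ) (hs0 : s ≠ 0) (t : ℝ) :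
    h.tubePoint (t, s) ∉ range γ := by
  rintro ⟨t', ht'⟩
  have h1 := h.inner_tubePoint_le hθ hs t t'
  rw [← ht', inner_coe_self, ← Real.cos_abs, ← Real.cos_zero] at h1
  exact absurd h1 (not_le.2 (Real.cos_lt_cos_of_nonneg_of_le_pi le_rfl (hs.trans hπ)
    (abs_pos.2 hs0)))

/-- At `γ t` the inner product of the curve with `tubePoint (t, s)` is maximal, so its second
derivative `‖γ'‖² (k sin s - cos s)` is at most 0. The choices `s = θ` and `s = -θ` bound `|k|`. -/
lemma abs_curvature_mul_sin_le (h : IsNormalFrame γ n k) (hθ : TubeNoOverlap γ θ) (h0 : 0 ≤ θ)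
    (t : ℝ) : |k t| * Real.sin θ ≤ Real.cos θ := by
  have key : ∀ s : ℝ, |s| ≤ θ → k t * Real.sin s ≤ Real.cos s := by
    intro s hs
    set q := h.tubePoint (t, s) with hq
    set g : ℝ → ℝ := fun t' => inner ℝ (q : E3) (γ t' : E3) with hg
    have hd : ∀ t', HasDerivAt g (inner ℝ (q : E3) (velocity γ t')) t' := fun t' => by
      simpa using (hasDerivAt_const t' (q : E3)).inner ℝ (h.curve.hasDerivAt t')
    have hd1 : deriv g = fun t' => inner ℝ (q : E3) (velocity γ t') := funext fun t' => (hd t').deriv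
    have hd2 : HasDerivAt (deriv g) (inner ℝ (q : E3) (deriv (velocity γ) t)) t := by
      rw [hd1]
      simpa using (hasDerivAt_const t (q : E3)).inner ℝ (h.curve.hasDerivAt_velocity t)
    have hmax : ∀ t', g t' ≤ g t := fun t' => by
      have h1 := h.inner_tubePoint_le hθ hs t t'
      rwa [← h.inner_tubePoint_curve t s] at h1
    have hg0 : deriv g t = 0 := by
      rw [hd1]
      exact IsLocalMax.hasDerivAt_eq_zero (Filter.Eventually.of_forall hmax) (hd t)
    have h2 : inner ℝ (q : E3) (deriv (velocity γ) t) ≤ (0 : ℝ) := by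
      by_contra hcon
      push Not at hcon
      -- A positive second derivative would make the maximum a local minimum too, hence the function
      -- locally constant, a contradiction.
      have hmin := isLocalMin_of_deriv_deriv_pos (by rwa [hd2.deriv]) hg0 (hd t).continuousAt
      have hconst : g =ᶠ[nhds t] fun _ => g t :=
        Filter.Eventually.mono hmin fun t' ht' => le_antisymm (hmax t') ht'
      have h3 : deriv g =ᶠ[nhds t] fun _ => 0 := by
        have h4 := hconst.deriv
        simpa using h4
      have h5 := h3.deriv_eq
      rw [hd2.deriv, deriv_const] at h5
      linarith
    have h3 : inner ℝ (n t) (deriv (velocity γ) t) = k t * ‖velocity γ t‖ ^ 2 := by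
      have h4 := (h.hasDerivAt t).inner ℝ (h.curve.hasDerivAt_velocity t)
      rw [funext h.inner_velocity] at h4
      have h5 := h4.unique (hasDerivAt_const t (0 : ℝ))
      rw [inner_smul_left, real_inner_self_eq_norm_sq] at h5
      simp only [conj_trivial] at h5
      linarith
    rw [hq, coe_tubePoint, inner_add_left, inner_smul_left, inner_smul_left, h3,
      real_inner_comm, h.curve.inner_deriv_velocity] at h2
    simp only [conj_trivial] at h2
    have hv : 0 < ‖velocity γ t‖ ^ 2 := by
      have := norm_pos_iff.2 (h.curve.regular t)
      positivity
    by_contra hcon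
    push Not at hcon
    nlinarith
  rcases abs_cases (k t) with ⟨h1, -⟩ | ⟨h1, -⟩ <;> rw [h1]
  · exact key θ (by rw [abs_of_nonneg h0])
  · have := key (-θ) (by rw [abs_neg, abs_of_nonneg h0])
    rw [Real.sin_neg, Real.cos_neg] at this
    linarith

end IsNormalFrame

/-! ### Numerical estimates. -/

section Estimates

variable {r ρ s a b : ℝ}

/-- Both bounds come from `tan ρ ≤ ρ / (1 - ρ²/2)` with `ρ < π/4 < 0.7875`. -/
lemma tan_le_of_lt {ρ : ℝ} (h0 : 0 < ρ) (h1 : ρ < Real.pi / 4) :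
    Real.tan ρ ≤ 3 / 2 * ρ ∧ Real.tan ρ ^ 2 - ρ ^ 2 ≤ 11 / 5 * ρ ^ 4 := by
  have hp := Real.pi_lt_d2
  have hlt : ρ < 0.7875 := by linarith
  have hc := Real.one_sub_sq_div_two_le_cos (x := ρ)
  have hs := Real.sin_le h0.le
  have hsq : ρ ^ 2 < 0.6202 := by nlinarith
  have hc1 : 0.6899 ≤ 1 - ρ ^ 2 / 2 := by linarith
  have hc0 : 0 < Real.cos ρ := by linarith
  have hu : Real.tan ρ ≤ ρ / (1 - ρ ^ 2 / 2) := by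
    rw [Real.tan_eq_sin_div_cos]
    gcongr
  constructor
  · refine hu.trans ?_
    rw [div_le_iff₀ (by linarith)]
    nlinarith
  · have ht0 : 0 ≤ Real.tan ρ :=
      (Real.tan_pos_of_pos_of_lt_pi_div_two h0 (by linarith [Real.pi_pos])).le
    have h2 : Real.tan ρ ^ 2 ≤ (ρ / (1 - ρ ^ 2 / 2)) ^ 2 := by gcongr
    have h3 : (ρ / (1 - ρ ^ 2 / 2)) ^ 2 ≤ ρ ^ 2 + 11 / 5 * ρ ^ 4 := by
      rw [div_pow, div_le_iff₀ (by nlinarith)]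
      set q := ρ ^ 2 with hq
      have hq0 : 0 ≤ q := sq_nonneg ρ
      have h4 : ρ ^ 4 = q ^ 2 := by rw [hq]; ring
      rw [h4]
      have h5 : 1 ≤ (1 + 11 / 5 * q) * (1 - q / 2) ^ 2 := by nlinarith [mul_nonneg hq0 hq0]
      nlinarith
    linarith

lemma sqrt_one_add_le (a b : ℝ) : √(1 + a ^ 2 + b ^ 2) ≤ 1 + (a ^ 2 + b ^ 2) / 2 := by
  rw [Real.sqrt_le_iff]
  exact ⟨by positivity, by nlinarith [sq_nonneg (a ^ 2 + b ^ 2)]⟩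

lemma le_sin_three_quarters (h0 : 0 < r) (hr : r < Real.pi / 2) :
    47 / 100 * r ≤ Real.sin (3 * r / 4) := by
  refine le_trans ?_ (Real.mul_le_sin (by linarith) (by linarith))
  have hp := Real.pi_lt_d2
  have hp0 := Real.pi_pos
  rw [div_mul_eq_mul_div 2, le_div_iff₀ hp0]
  nlinarith

/-- In gnomonic coordinates around a point at distance `s` from the curve, the points beyond the
curve by more than `10 ρ² / r` lie in the cap touching the curve from the far side. -/
lemma mem_far_cap_estimate (hr : r < Real.pi / 2) (hρ : 0 < ρ) (hρr : ρ < r / 2) (hs0 : 0 ≤ s)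
    (hs : s ≤ ρ) (hab : a ^ 2 + b ^ 2 < ρ ^ 2) (ha : s + 10 * ρ ^ 2 / r < a) :
    Real.cos (3 * r / 4) * √(1 + a ^ 2 + b ^ 2) <
      Real.cos (3 * r / 4) * (Real.cos s + a * Real.sin s) -
        Real.sin (3 * r / 4) * (Real.sin s - a * Real.cos s) := by
  have hr0 : 0 < r := by linarith
  have hp := Real.pi_lt_d2
  have hρ1 : ρ < 1 := by linarith
  have hS := le_sin_three_quarters hr0 hr
  have hS1 := Real.sin_le_one (3 * r / 4)
  have hC0 : 0 < Real.cos (3 * r / 4) := Real.cos_pos_of_mem_Ioo ⟨by linarith, by linarith⟩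
  have hC1 := Real.cos_le_one (3 * r / 4)
  set S := Real.sin (3 * r / 4)
  set C := Real.cos (3 * r / 4)
  have hc := Real.one_sub_sq_div_two_le_cos (x := s)
  have hσ := Real.sin_le hs0
  have hσ0 : 0 ≤ Real.sin s := Real.sin_nonneg_of_nonneg_of_le_pi hs0 (by linarith [Real.pi_gt_three])
  have hsq := sqrt_one_add_le a b
  have hd : 0 < 10 * ρ ^ 2 / r := by positivity
  have ha0 : 0 < a := by linarith
  have haρ : a ≤ ρ := by nlinarith [sq_nonneg b]
  have hss : s ^ 2 ≤ ρ ^ 2 := by gcongr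
  have h1 : -ρ ^ 2 ≤ Real.cos s + a * Real.sin s - √(1 + a ^ 2 + b ^ 2) := by
    have := mul_nonneg ha0.le hσ0
    linarith
  have h2 : -ρ ^ 2 ≤ C * (Real.cos s + a * Real.sin s - √(1 + a ^ 2 + b ^ 2)) := by
    nlinarith [sq_nonneg ρ]
  have h3 : 10 * ρ ^ 2 / r - ρ ^ 2 / 2 ≤ a * Real.cos s - Real.sin s := by
    have h4 : a * (1 - s ^ 2 / 2) ≤ a * Real.cos s := mul_le_mul_of_nonneg_left hc ha0.le
    have h5 : a * s ^ 2 ≤ 1 * ρ ^ 2 := mul_le_mul (by linarith) hss (sq_nonneg s) zero_le_one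
    linarith
  have hS0 : 0 < S := lt_of_lt_of_le (by positivity) hS
  -- The gain `4.7ρ²` from the offset exceeds the accumulated losses `ρ² + ρ²/2`.
  have h6 : 47 / 10 * ρ ^ 2 ≤ S * (10 * ρ ^ 2 / r) := by
    refine le_trans (le_of_eq ?_) (mul_le_mul_of_nonneg_right hS hd.le)
    field_simp
    norm_num
  have h7 := mul_le_mul_of_nonneg_left h3 hS0.le
  have h8 : S * ρ ^ 2 ≤ 1 * ρ ^ 2 := by gcongr
  nlinarith [sq_pos_of_pos hρ]

/-- In gnomonic coordinates around a point at distance `s` from the curve, the points before the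
curve by more than `10 ρ² / r` lie in the cap touching the curve from the near side. -/
lemma mem_near_cap_estimate (hr : r < Real.pi / 2) (hρ : 0 < ρ) (hρr : ρ < r / 2) (hs0 : 0 ≤ s)
    (hs : s ≤ ρ) (hab : a ^ 2 + b ^ 2 < Real.tan ρ ^ 2) (ha : a ≤ s - 10 * ρ ^ 2 / r) :
    Real.cos (3 * r / 4) * √(1 + a ^ 2 + b ^ 2) <
      Real.cos (3 * r / 4) * (Real.cos s + a * Real.sin s) +
        Real.sin (3 * r / 4) * (Real.sin s - a * Real.cos s) := by
  have hr0 : 0 < r := by linarith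
  have hp := Real.pi_lt_d2
  have hρ1 : ρ < 1 := by linarith
  have hS := le_sin_three_quarters hr0 hr
  have hS1 := Real.sin_le_one (3 * r / 4)
  have hC0 : 0 < Real.cos (3 * r / 4) := Real.cos_pos_of_mem_Ioo ⟨by linarith, by linarith⟩
  have hC1 := Real.cos_le_one (3 * r / 4)
  set S := Real.sin (3 * r / 4)
  set C := Real.cos (3 * r / 4)
  have hc := Real.one_sub_sq_div_two_le_cos (x := s)
  have hc1 := Real.cos_le_one s
  have hσ := Real.sin_le hs0
  have hσ0 : 0 ≤ Real.sin s := Real.sin_nonneg_of_nonneg_of_le_pi hs0 (by linarith [Real.pi_gt_three])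
  have hσ3 : s - s ^ 3 / 4 ≤ Real.sin s := by
    rcases hs0.eq_or_lt with rfl | hs0'
    · simp
    · linarith [Real.sin_gt_sub_cube hs0', pow_pos hs0' 3]
  have hsq := sqrt_one_add_le a b
  have hd : 0 < 10 * ρ ^ 2 / r := by positivity
  have hT := (tan_le_of_lt hρ (by linarith)).1
  have hT0 : 0 ≤ Real.tan ρ :=
    (Real.tan_pos_of_pos_of_lt_pi_div_two hρ (by linarith [Real.pi_pos])).le
  have hT2 : Real.tan ρ ^ 2 ≤ (3 / 2 * ρ) ^ 2 := by gcongr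
  have haT : |a| ≤ 3 / 2 * ρ := abs_le_of_sq_le_sq (by nlinarith [sq_nonneg b]) (by linarith)
  have hss : s ^ 2 ≤ ρ ^ 2 := by gcongr
  have h0 : |a * Real.sin s| ≤ 3 / 2 * ρ * ρ := by
    rw [abs_mul, abs_of_nonneg hσ0]
    exact mul_le_mul haT (hσ.trans hs) hσ0 (by linarith)
  have h1 : -(25 / 8 * ρ ^ 2) ≤ Real.cos s + a * Real.sin s - √(1 + a ^ 2 + b ^ 2) := by
    have := (abs_le.1 h0).1
    nlinarith
  have h2 : -(25 / 8 * ρ ^ 2) ≤ C * (Real.cos s + a * Real.sin s - √(1 + a ^ 2 + b ^ 2)) := by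
    nlinarith [sq_nonneg ρ]
  have h3 : 10 * ρ ^ 2 / r - ρ ^ 2 ≤ Real.sin s - a * Real.cos s := by
    have h4 : |a * (1 - Real.cos s)| ≤ 3 / 2 * (ρ ^ 2 / 2) := by
      rw [abs_mul, abs_of_nonneg (by linarith : 0 ≤ 1 - Real.cos s)]
      exact mul_le_mul (by linarith) (by linarith) (by linarith) (by linarith)
    have h5 := (abs_le.1 h4).1
    have h6 : s ^ 3 ≤ ρ ^ 2 := by
      calc s ^ 3 = s * s ^ 2 := by ring
        _ ≤ 1 * ρ ^ 2 := mul_le_mul (by linarith) hss (sq_nonneg s) zero_le_one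
        _ = ρ ^ 2 := one_mul _
    linarith
  have hS0 : 0 < S := lt_of_lt_of_le (by positivity) hS
  -- The losses here are `25/8 ρ² + ρ² = 4.125ρ²`, still below `4.7ρ²`; this is the tighter use of
  -- the constant 10.
  have h6 : 47 / 10 * ρ ^ 2 ≤ S * (10 * ρ ^ 2 / r) := by
    refine le_trans (le_of_eq ?_) (mul_le_mul_of_nonneg_right hS hd.le)
    field_simp
    norm_num
  have h7 := mul_le_mul_of_nonneg_left h3 hS0.le
  have h8 : S * ρ ^ 2 ≤ 1 * ρ ^ 2 := by gcongr
  nlinarith [sq_pos_of_pos hρ]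

/-- Absorbs fourth-order errors into `ρ³ / r`, since `ρ r < r²/2 < π²/8`. -/
lemma pow_four_le (hr : r < Real.pi / 2) (hρ : 0 < ρ) (hρr : ρ < r / 2) :
    ρ ^ 4 ≤ 5 / 4 * (ρ ^ 3 / r) := by
  have hr0 : 0 < r := by linarith
  have hp := Real.pi_lt_d2
  have h1 : ρ * r ≤ 5 / 4 := by nlinarith
  rw [mul_div_assoc', le_div_iff₀ hr0]
  nlinarith [pow_pos hρ 3]

end Estimates

/-! ### The two sides of the curve and the touching caps. -/

/-- The curve divides its tube into a part inside `A` and a part outside `A`. -/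
structure IsInnerFrame (γ : ℝ → S2) (n : ℝ → E3) (k : ℝ → ℝ) (A : Set S2) (r : ℝ) : Prop where
  frame : IsNormalFrame γ n k
  frontier_eq : frontier A = range γ
  noOverlap : ∀ θ : ℝ, 0 < θ → θ < r → TubeNoOverlap γ θ
  lt_pi_div_two : r < Real.pi / 2
  mem_interior : ∀ t s, 0 < s → s < r → frame.tubePoint (t, s) ∈ interior A
  mem_exterior : ∀ t s, 0 < s → s < r → frame.tubePoint (t, -s) ∈ interior Aᶜ

namespace IsNormalFrame

variable {γ : ℝ → S2} {n : ℝ → E3} {k : ℝ → ℝ} {A : Set S2} {r : ℝ}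

/-- The open half-tube is a continuous image of a connected set and misses the frontier. -/
lemma side_dichotomy (h : IsNormalFrame γ n k) (hA : frontier A = range γ)
    (hθ : ∀ θ : ℝ, 0 < θ → θ < r → TubeNoOverlap γ θ) (hr : r < Real.pi / 2) :
    (∀ t s, 0 < s → s < r → h.tubePoint (t, s) ∈ interior A) ∨
      (∀ t s, 0 < s → s < r → h.tubePoint (t, s) ∈ interior Aᶜ) := by
  have hU : IsPreconnected (h.tubePoint '' (univ ×ˢ Ioo 0 r)) :=
    (isPreconnected_univ.prod isPreconnected_Ioo).image _ h.continuous_tubePoint.continuousOn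
  have hdis : Disjoint (h.tubePoint '' (univ ×ˢ Ioo 0 r)) (frontier A) := by
    rw [disjoint_left, hA]
    rintro _ ⟨⟨t, s⟩, ⟨-, hs⟩, rfl⟩
    have hs' : |s| = s := abs_of_pos hs.1
    exact h.tubePoint_notMem_range (hθ s hs.1 hs.2)
      (by linarith [Real.pi_pos, hs.2, show (t, s).2 = s from rfl]) hs'.le hs.1.ne' t
  rcases subset_interior_or_of_disjoint_frontier hU hdis with h1 | h1
  · exact Or.inl fun t s h2 h3 => h1 ⟨(t, s), ⟨mem_univ _, h2, h3⟩, rfl⟩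
  · exact Or.inr fun t s h2 h3 => h1 ⟨(t, s), ⟨mem_univ _, h2, h3⟩, rfl⟩

lemma not_both_sides_interior (h : IsNormalFrame γ n k) (hA : frontier A = range γ)
    (hint : (interior A).Nonempty) (hext : (interior Aᶜ).Nonempty) (hr0 : 0 < r)
    (hr : r < Real.pi / 2)
    (h1 : ∀ t s, 0 < s → s < r → h.tubePoint (t, s) ∈ interior A)
    (h2 : ∀ t s, 0 < s → s < r → h.tubePoint (t, -s) ∈ interior A) : False := by
  have hdisj : Disjoint (interior A) (interior Aᶜ) :=
    disjoint_compl_right.mono interior_subset interior_subset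
  -- A limit of exterior points outside the exterior would lie on the curve. Nearby exterior points
  -- would then lie in the tube, whose points off the curve are all interior to `A`. So the exterior
  -- is clopen, against connectedness of the sphere.
  have hclosed : IsClosed (interior Aᶜ) := by
    refine isClosed_of_closure_subset fun p hp => ?_
    by_contra hpO
    have hpA : p ∉ interior A := fun hpA => by
      obtain ⟨y, hy1, hy2⟩ := mem_closure_iff.1 hp _ isOpen_interior hpA
      exact hdisj.ne_of_mem hy1 hy2 rfl
    have hpf : p ∈ frontier A := ⟨by rwa [interior_compl, notMem_compl_iff] at hpO, hpA⟩
    rw [hA] at hpf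
    obtain ⟨t, rfl⟩ := hpf
    have hopen : IsOpen {x : S2 | Real.cos r < inner ℝ (x : E3) (γ t : E3)} :=
      isOpen_lt continuous_const (continuous_subtype_val.inner continuous_const)
    have hmem : γ t ∈ {x : S2 | Real.cos r < inner ℝ (x : E3) (γ t : E3)} := by
      rw [mem_ofPred_eq, inner_coe_self, ← Real.cos_zero]
      exact Real.cos_lt_cos_of_nonneg_of_le_pi le_rfl (by linarith [Real.pi_pos]) hr0
    obtain ⟨x, hx, hxO⟩ := mem_closure_iff.1 hp _ hopen hmem
    obtain ⟨t₁, -, s, hs, rfl, hle⟩ := h.exists_eq_tubePoint x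
    have hlt : |s| < r := by
      have h3 : Real.cos r < Real.cos |s| := by
        rw [Real.cos_abs]
        exact lt_of_lt_of_le hx (hle t)
      by_contra hcon
      exact absurd h3 (not_lt.2 (Real.cos_le_cos_of_nonneg_of_le_pi hr0.le hs (not_lt.1 hcon)))
    rcases lt_trichotomy s 0 with h0 | h0 | h0
    · rw [abs_of_neg h0] at hlt
      have h4 := h2 t₁ (-s) (by linarith) hlt
      rw [neg_neg] at h4
      exact hdisj.ne_of_mem h4 hxO rfl
    · rw [h0, h.tubePoint_zero] at hxO
      have h5 : γ t₁ ∈ frontier A := by rw [hA]; exact mem_range_self _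
      rw [interior_compl] at hxO
      exact hxO h5.1
    · rw [abs_of_pos h0] at hlt
      exact hdisj.ne_of_mem (h1 t₁ s h0 hlt) hxO rfl
  have := preconnectedSpace_S2
  have huniv : interior Aᶜ = univ := IsClopen.eq_univ ⟨hclosed, isOpen_interior⟩ hext
  obtain ⟨y, hy⟩ := hint
  exact hdisj.ne_of_mem hy (huniv ▸ mem_univ y) rfl

end IsNormalFrame

theorem exists_isInnerFrame {γ : ℝ → S2} (hγ : IsSmoothSimpleClosedCurve γ) {A : Set S2}
    (hA : frontier A = range γ) (hint : (interior A).Nonempty) (hext : (interior Aᶜ).Nonempty)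
    {r : ℝ} (hr0 : 0 < r) (hr : r < Real.pi / 2)
    (hθ : ∀ θ : ℝ, 0 < θ → θ < r → TubeNoOverlap γ θ) :
    ∃ n k, IsInnerFrame γ n k A r := by
  obtain ⟨n, k, h⟩ := exists_isNormalFrame hγ
  have hn := h.neg.side_dichotomy hA hθ hr
  simp only [h.neg_tubePoint] at hn
  rcases h.side_dichotomy hA hθ hr with h1 | h1 <;> rcases hn with h2 | h2
  · exact (h.not_both_sides_interior hA hint hext hr0 hr h1 h2).elim
  · exact ⟨n, k, h, hA, hθ, hr, h1, h2⟩
  · refine ⟨-n, -k, h.neg, hA, hθ, hr, ?_, ?_⟩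
    · simpa only [h.neg_tubePoint] using h2
    · simpa only [h.neg_tubePoint, neg_neg] using h1
  · refine (h.not_both_sides_interior (A := Aᶜ) ?_ hext ?_ hr0 hr h1 h2).elim
    · rw [frontier_compl, hA]
    · rwa [compl_compl]

namespace IsInnerFrame

variable {γ : ℝ → S2} {n : ℝ → E3} {k : ℝ → ℝ} {A : Set S2} {r : ℝ}

lemma cap_disjoint_frontier (h : IsInnerFrame γ n k A r) {θ : ℝ} (h0 : 0 < θ) (hθr : θ < r) {s : ℝ}
    (hs : |s| = θ) (t : ℝ) : Disjoint (cap (h.frame.tubePoint (t, s)) θ) (frontier A) := by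
  have hr := h.lt_pi_div_two
  rw [disjoint_left, h.frontier_eq]
  rintro _ hx ⟨t', rfl⟩
  rw [mem_cap_iff h0.le (by linarith [Real.pi_pos])] at hx
  have h1 := h.frame.inner_tubePoint_le (h.noOverlap θ h0 hθr) hs.le t t'
  rw [← Real.cos_abs s, hs] at h1
  exact absurd hx (not_lt.2 h1)

/-- The cap is connected and misses the frontier, and its centre already lies in `A`. -/
lemma cap_subset_interior (h : IsInnerFrame γ n k A r) {θ : ℝ} (h0 : 0 < θ) (hθr : θ < r) (t : ℝ) :
    cap (h.frame.tubePoint (t, θ)) θ ⊆ interior A := by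
  have hr := h.lt_pi_div_two
  have hp := Real.pi_pos
  rcases subset_interior_or_of_disjoint_frontier
    (isPreconnected_cap h0 (by linarith)) (h.cap_disjoint_frontier h0 hθr (abs_of_pos h0) t) with h1 | h1
  · exact h1
  · have hm : h.frame.tubePoint (t, θ) ∈ cap (h.frame.tubePoint (t, θ)) θ := by
      rw [mem_cap_iff h0.le (by linarith), inner_coe_self, ← Real.cos_zero]
      exact Real.cos_lt_cos_of_nonneg_of_le_pi le_rfl (by linarith) h0
    exact absurd (interior_subset (h.mem_interior t θ h0 hθr)) (interior_subset (h1 hm))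

lemma cap_subset_exterior (h : IsInnerFrame γ n k A r) {θ : ℝ} (h0 : 0 < θ) (hθr : θ < r) (t : ℝ) :
    cap (h.frame.tubePoint (t, -θ)) θ ⊆ interior Aᶜ := by
  have hr := h.lt_pi_div_two
  have hp := Real.pi_pos
  rcases subset_interior_or_of_disjoint_frontier (isPreconnected_cap h0 (by linarith))
    (h.cap_disjoint_frontier h0 hθr (s := -θ) (by rw [abs_neg, abs_of_pos h0]) t) with h1 | h1
  · have hm : h.frame.tubePoint (t, -θ) ∈ cap (h.frame.tubePoint (t, -θ)) θ := by
      rw [mem_cap_iff h0.le (by linarith), inner_coe_self, ← Real.cos_zero]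
      exact Real.cos_lt_cos_of_nonneg_of_le_pi le_rfl (by linarith) h0
    exact absurd (interior_subset (h1 hm)) (interior_subset (h.mem_exterior t θ h0 hθr))
  · exact h1

end IsInnerFrame

/-! ### Comparison of a cap near the curve with a disc segment, and the Jacobian bound. -/

namespace IsNormalFrame

variable {γ : ℝ → S2} {n : ℝ → E3} {k : ℝ → ℝ}

/-- The unit vector at a point of the tube that points towards the curve. -/
def towards (γ : ℝ → S2) (n : ℝ → E3) (t s : ℝ) : E3 :=
  Real.sin s • (γ t : E3) - Real.cos s • n t

/-- The unit tangent vector of the curve. -/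
def tangent (γ : ℝ → S2) (t : ℝ) : E3 :=
  ‖velocity γ t‖⁻¹ • velocity γ t

lemma orthonormal_towards (h : IsNormalFrame γ n k) (t s : ℝ) :
    Orthonormal ℝ ![(h.tubePoint (t, s) : E3), towards γ n t s, tangent γ t] := by
  obtain ⟨h1, h2, h3, h4, h5, h6⟩ := inner_eq_zero_or_one
    (orthonormal_frame (inner_coe_self (γ t)) (h.inner_self t) (h.curve.regular t)
      (h.inner_curve t) (h.inner_velocity t) (h.curve.inner_velocity t))
  have h4' := real_inner_comm (γ t : E3) (n t) ▸ h4
  refine orthonormal_triple (inner_coe_self _) ?_ h3 ?_ ?_ ?_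
  · simp only [towards, inner_sub_left, inner_sub_right, inner_smul_left, inner_smul_right,
      conj_trivial, h1, h2, h4, h4']
    linarith [Real.sin_sq_add_cos_sq s]
  · simp only [towards, coe_tubePoint, inner_sub_right, inner_add_left, inner_smul_left,
      inner_smul_right, conj_trivial, h1, h2, h4, h4']
    ring
  · simp only [coe_tubePoint, tangent, inner_add_left, inner_smul_left, h5, h6]
    ring
  · simp only [towards, tangent, inner_sub_left, inner_smul_left, h5, h6]
    ring

lemma gnomonicPoint_mem_cap_iff (h : IsNormalFrame γ n k) (t s : ℝ) (w : ℝ × ℝ) {R : ℝ}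
    (h0 : 0 ≤ R) (hπ : R ≤ Real.pi) (u : ℝ) :
    gnomonicPoint (h.orthonormal_towards t s) w ∈ cap (h.tubePoint (t, u)) R ↔
      Real.cos R * √(1 + w.1 ^ 2 + w.2 ^ 2) <
        Real.cos u * (Real.cos s + w.1 * Real.sin s) +
          Real.sin u * (Real.sin s - w.1 * Real.cos s) := by
  obtain ⟨h1, h2, h3, h4, h5, h6⟩ := inner_eq_zero_or_one
    (orthonormal_frame (inner_coe_self (γ t)) (h.inner_self t) (h.curve.regular t)
      (h.inner_curve t) (h.inner_velocity t) (h.curve.inner_velocity t))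
  have h4' := real_inner_comm (γ t : E3) (n t) ▸ h4
  have hpos : 0 < √(1 + w.1 ^ 2 + w.2 ^ 2) := by positivity
  rw [mem_cap_iff h0 hπ, gnomonicPoint, inner_smul_right,
    norm_gnomonic (h.orthonormal_towards t s), inv_mul_eq_div,
    lt_div_iff₀ hpos]
  have hin : inner ℝ (h.tubePoint (t, u) : E3)
      (gnomonic (h.tubePoint (t, s)) (towards γ n t s) (tangent γ t) w) =
      Real.cos u * (Real.cos s + w.1 * Real.sin s) +
          Real.sin u * (Real.sin s - w.1 * Real.cos s) := by
    simp only [gnomonic, towards, tangent, coe_tubePoint, inner_sub_right, inner_add_left,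
      inner_add_right, inner_smul_left _ _ (Real.cos u), inner_smul_left _ _ (Real.sin u),
      inner_smul_right _ _ w.1, inner_smul_right _ _ w.2, inner_smul_right _ _ (Real.cos s),
      inner_smul_right _ _ (Real.sin s), conj_trivial, h1, h2, h4, h4', h5, h6]
    ring
  rw [hin]

end IsNormalFrame

namespace IsInnerFrame

variable {γ : ℝ → S2} {n : ℝ → E3} {k : ℝ → ℝ} {A : Set S2} {r : ℝ}

/-- The area of the part of a cap outside `A` is that of a part of a Euclidean disc cut off by a
line, up to a small error. -/
theorem sigma_cap_sdiff_bounds (h : IsInnerFrame γ n k A r) {ρ s : ℝ} (hρ : 0 < ρ)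
    (hρr : ρ < r / 2) (hs0 : 0 ≤ s) (hs : s ≤ ρ) (t : ℝ) :
    ENNReal.ofReal (1 / (4 * Real.pi) * (discPartArea ρ s - 40 * (ρ ^ 3 / r))) ≤
        sigma (cap (h.frame.tubePoint (t, s)) ρ \ interior A) ∧
      sigma (cap (h.frame.tubePoint (t, s)) ρ \ interior A) ≤
        ENNReal.ofReal (1 / (4 * Real.pi) * (discPartArea ρ s + 40 * (ρ ^ 3 / r))) := by
  have hr := h.lt_pi_div_two
  have hr0 : 0 < r := by linarith
  have hp := Real.pi_pos
  have hp2 := Real.pi_lt_d2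
  have h4 := pow_four_le hr hρ hρr
  have he : 0 < ρ ^ 3 / r := by positivity
  have hδ : 0 ≤ 10 * ρ ^ 2 / r := by positivity
  rw [sdiff_eq]
  constructor
  · refine le_trans (ENNReal.ofReal_le_ofReal ?_)
      (le_sigma_cap_inter (h.frame.orthonormal_towards t s) hρ (by linarith) hs0 hs hδ
        fun w hw hw1 hwA => ?_)
    · refine mul_le_mul_of_nonneg_left ?_ (by positivity)
      have h5 : 2 * (10 * ρ ^ 2 / r) * ρ = 20 * (ρ ^ 3 / r) := by ring
      linarith
    · have h6 : gnomonicPoint (h.frame.orthonormal_towards t s) w ∈ interior Aᶜ := by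
        apply h.cap_subset_exterior (θ := 3 * r / 4) (by linarith) (by linarith) t
        rw [h.frame.gnomonicPoint_mem_cap_iff _ _ _ (by linarith) (by linarith), Real.cos_neg,
          Real.sin_neg, neg_mul, ← sub_eq_add_neg]
        exact mem_far_cap_estimate hr hρ hρr hs0 hs hw hw1
      exact interior_subset h6 (interior_subset hwA)
  -- The upper bound dictates 40: the strip costs 30, and the annulus costs `7ρ⁴`, at most `35/4`
  -- units of `ρ³ / r`.
  · refine le_trans (sigma_cap_inter_le (h.frame.orthonormal_towards t s) hρ (by linarith) hs0 hs hδ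
        fun w hw hw1 hwA => ?_) (ENNReal.ofReal_le_ofReal ?_)
    · refine hwA ?_
      apply h.cap_subset_interior (θ := 3 * r / 4) (by linarith) (by linarith) t
      rw [h.frame.gnomonicPoint_mem_cap_iff _ _ _ (by linarith) (by linarith)]
      exact mem_near_cap_estimate hr hρ hρr hs0 hs hw hw1
    · refine mul_le_mul_of_nonneg_left ?_ (by positivity)
      obtain ⟨h5, h6⟩ := tan_le_of_lt hρ (by linarith)
      have h7 : 2 * (10 * ρ ^ 2 / r) * Real.tan ρ ≤ 30 * (ρ ^ 3 / r) := by
        refine (mul_le_mul_of_nonneg_left h5 (by positivity)).trans (le_of_eq ?_)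
        ring
      have h8 : Real.pi * (Real.tan ρ ^ 2 - ρ ^ 2) ≤ 7 * ρ ^ 4 := by
        have h9 : 0 ≤ 11 / 5 * ρ ^ 4 := by positivity
        nlinarith [mul_le_mul_of_nonneg_left h6 hp.le]
      linarith

/-- The bound `|k| ≤ cot (3r/4)` combined with `x ≤ tan x`. -/
lemma abs_curvature_le (h : IsInnerFrame γ n k A r) (hr0 : 0 < r) (t : ℝ) :
    |k t| ≤ 4 / (3 * r) := by
  have hr := h.lt_pi_div_two
  have h1 := h.frame.abs_curvature_mul_sin_le (h.noOverlap (3 * r / 4) (by linarith) (by linarith))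
    (by linarith) t
  have hc : 0 < Real.cos (3 * r / 4) := Real.cos_pos_of_mem_Ioo ⟨by linarith, by linarith⟩
  have h2 : 3 * r / 4 * Real.cos (3 * r / 4) ≤ Real.sin (3 * r / 4) := by
    have h3 := Real.lt_tan (show 0 < 3 * r / 4 by linarith) (by linarith)
    rw [Real.tan_eq_sin_div_cos, lt_div_iff₀ hc] at h3
    exact h3.le
  have h4 : |k t| * (3 * r / 4) * Real.cos (3 * r / 4) ≤ 1 * Real.cos (3 * r / 4) := by
    rw [mul_assoc, one_mul]
    exact (mul_le_mul_of_nonneg_left h2 (abs_nonneg _)).trans h1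
  have h5 := le_of_mul_le_mul_right h4 hc
  rw [le_div_iff₀ (by positivity)]
  linarith

/-- The Jacobian factor of the tube coordinates is close to one. -/
lemma abs_jacobian_sub_one_le (h : IsInnerFrame γ n k A r) {s : ℝ} (hs0 : 0 ≤ s)
    (hs : s ≤ r / 2) (hr0 : 0 < r) (t : ℝ) :
    |(|Real.cos s - k t * Real.sin s| - 1)| ≤ 2 * s / r := by
  have hr := h.lt_pi_div_two
  have hp := Real.pi_lt_d2
  have h1 : |(|Real.cos s - k t * Real.sin s| - 1)| ≤ |Real.cos s - k t * Real.sin s - 1| := by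
    have := abs_abs_sub_abs_le (Real.cos s - k t * Real.sin s) 1
    rwa [abs_one] at this
  have hσ0 : 0 ≤ Real.sin s := Real.sin_nonneg_of_nonneg_of_le_pi hs0 (by linarith [Real.pi_pos])
  have h2 : |k t * Real.sin s| ≤ 4 / (3 * r) * s := by
    rw [abs_mul, abs_of_nonneg hσ0]
    exact mul_le_mul (h.abs_curvature_le hr0 t) (Real.sin_le hs0) hσ0 (by positivity)
  have hc := Real.one_sub_sq_div_two_le_cos (x := s)
  have hc1 := Real.cos_le_one s
  have h3 : |Real.cos s - k t * Real.sin s - 1| ≤ s ^ 2 / 2 + 4 / (3 * r) * s := by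
    have h4 := abs_le.1 h2
    rw [abs_le]
    constructor <;> nlinarith [sq_nonneg s]
  refine h1.trans (h3.trans ?_)
  rw [le_div_iff₀ hr0]
  have h5 : (s ^ 2 / 2 + 4 / (3 * r) * s) * r = s * (s * r / 2 + 4 / 3) := by
    field_simp
  rw [h5]
  -- What remains is `s r / 2 + 4/3 ≤ 2`, true because `s r / 2 ≤ r²/4 < π²/16`.
  nlinarith

end IsInnerFrame

/-! ### Integration in tube coordinates. -/

namespace IsNormalFrame

variable {γ : ℝ → S2} {n : ℝ → E3} {k : ℝ → ℝ}

/-- The derivative of the tube coordinates. -/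
def tubeDeriv (γ : ℝ → S2) (n : ℝ → E3) (k : ℝ → ℝ) (w : ℝ × ℝ) : ℝ × ℝ →L[ℝ] E3 :=
  (ContinuousLinearMap.fst ℝ ℝ ℝ).smulRight
      ((Real.cos w.2 - k w.1 * Real.sin w.2) • velocity γ w.1) +
    (ContinuousLinearMap.snd ℝ ℝ ℝ).smulRight (-towards γ n w.1 w.2)

lemma hasFDerivAt_tubePoint (h : IsNormalFrame γ n k) (w : ℝ × ℝ) :
    HasFDerivAt (fun w => (h.tubePoint w : E3)) (tubeDeriv γ n k w) w := by
  have h1 := (h.curve.hasDerivAt w.1).hasFDerivAt.comp w hasFDerivAt_fst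
  have h2 := (h.hasDerivAt w.1).hasFDerivAt.comp w hasFDerivAt_fst
  have h3 := (Real.hasDerivAt_cos w.2).hasFDerivAt.comp w hasFDerivAt_snd
  have h4 := (Real.hasDerivAt_sin w.2).hasFDerivAt.comp w hasFDerivAt_snd
  refine ((h3.smul h1).add (h4.smul h2)).congr_fderiv ?_
  ext <;> simp [tubeDeriv, towards] <;> ring

lemma abs_det3_tubeDeriv (h : IsNormalFrame γ n k) (w : ℝ × ℝ) :
    |det3 (h.tubePoint w) (tubeDeriv γ n k w (1, 0)) (tubeDeriv γ n k w (0, 1))| =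
      |Real.cos w.2 - k w.1 * Real.sin w.2| * ‖velocity γ w.1‖ := by
  obtain ⟨h1, h2, h3, h4, h5, h6⟩ := inner_eq_zero_or_one (h.orthonormal_towards w.1 w.2)
  have horth := orthonormal_triple h1 h3 h2 h5 h4 (by rwa [real_inner_comm])
  have hv : ‖velocity γ w.1‖ ≠ 0 := norm_ne_zero_iff.2 (h.curve.regular w.1)
  have e0 : (h.tubePoint w : E3) = (1 : ℝ) • (h.tubePoint (w.1, w.2) : E3) := by rw [one_smul]
  have e1 : tubeDeriv γ n k w (1, 0) =
      ((Real.cos w.2 - k w.1 * Real.sin w.2) * ‖velocity γ w.1‖) • tangent γ w.1 := by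
    rw [tangent, mul_smul, smul_inv_smul₀ hv]
    simp [tubeDeriv]
  have e2 : tubeDeriv γ n k w (0, 1) = (-1 : ℝ) • towards γ n w.1 w.2 := by
    simp [tubeDeriv]
  rw [e0, e1, e2, det3_smul, abs_mul, abs_det3_of_orthonormal horth]
  simp [abs_mul]

/-- Integration over a part of the sphere in tube coordinates. -/
lemma setLIntegral_image_tubePoint (h : IsNormalFrame γ n k) {D : Set (ℝ × ℝ)}
    (hD : MeasurableSet D) (hinj : InjOn h.tubePoint D) {f : S2 → ENNReal} (hf : Measurable f) :
    ∫⁻ x in h.tubePoint '' D, f x ∂sigma = ENNReal.ofReal (1 / (4 * Real.pi)) *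
      ∫⁻ w in D, ENNReal.ofReal (|Real.cos w.2 - k w.1 * Real.sin w.2| * ‖velocity γ w.1‖) *
        f (h.tubePoint w) := by
  have hn : ∀ w, ‖(h.tubePoint w : E3)‖ = 1 := fun w => mem_sphere_zero_iff_norm.1 (h.tubePoint w).2
  have hv : Measurable (velocity γ) := h.curve.contDiff_velocity.continuous.measurable
  have hk := h.measurable
  have hJ : Measurable fun w : ℝ × ℝ =>
      |Real.cos w.2 - k w.1 * Real.sin w.2| * ‖velocity γ w.1‖ := by
    have h1 : Measurable fun w : ℝ × ℝ => ‖velocity γ w.1‖ := (hv.comp measurable_fst).norm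
    have h2 : Measurable fun w : ℝ × ℝ => k w.1 := hk.comp measurable_fst
    have h3 : Measurable fun w : ℝ × ℝ => Real.cos w.2 := Real.measurable_cos.comp measurable_snd
    have h4 : Measurable fun w : ℝ × ℝ => Real.sin w.2 := Real.measurable_sin.comp measurable_snd
    exact (continuous_abs.measurable.comp (h3.sub (h2.mul h4))).mul h1
  have := setLIntegral_image_sigma hD h.hasFDerivAt_tubePoint h.continuous_tubePoint
    (fun w => by rw [hn, one_smul]) (fun w => norm_ne_zero_iff.1 (by rw [hn]; norm_num)) hinj hJ
    (fun w _ => h.abs_det3_tubeDeriv w) hf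
  rw [this]
  simp only [hn, one_pow, div_one]

/-- The curve is the tube image of a segment on the axis `s = 0`, a null set of the plane. -/
lemma sigma_range_curve (h : IsNormalFrame γ n k) : sigma (range γ) = 0 := by
  set D : Set (ℝ × ℝ) := Ico 0 1 ×ˢ {0} with hD
  have hinj : InjOn h.tubePoint D := by
    rintro ⟨t, _⟩ ⟨ht, rfl⟩ ⟨t', _⟩ ⟨ht', rfl⟩ heq
    simp only [h.tubePoint_zero] at heq
    exact congrArg (fun t => (t, (0 : ℝ))) (h.curve.simple ht ht' heq)
  have hrange : range γ ⊆ h.tubePoint '' D := by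
    rintro _ ⟨t, rfl⟩
    obtain ⟨t', ht', heq⟩ := h.curve.periodic.exists_mem_Ico₀ one_pos t
    exact ⟨(t', 0), ⟨ht', rfl⟩, by rw [h.tubePoint_zero, heq]⟩
  have hvol : volume D = 0 := by
    rw [hD, Measure.volume_eq_prod, Measure.prod_prod, Real.volume_singleton, mul_zero]
  refine measure_mono_null hrange ?_
  rw [← setLIntegral_one, h.setLIntegral_image_tubePoint
    (measurableSet_Ico.prod (measurableSet_singleton 0)) hinj measurable_const,
    Measure.restrict_eq_zero.2 hvol, lintegral_zero_measure, mul_zero]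

end IsNormalFrame

lemma isOpen_setOf_mem_cap {ρ : ℝ} (h0 : 0 ≤ ρ) (hπ : ρ ≤ Real.pi) :
    IsOpen {p : S2 × S2 | p.2 ∈ cap p.1 ρ} := by
  simp only [mem_cap_iff h0 hπ]
  exact isOpen_lt continuous_const ((continuous_subtype_val.comp continuous_fst).inner
    (continuous_subtype_val.comp continuous_snd))

lemma measurable_sigma_cap_sdiff {ρ : ℝ} (h0 : 0 ≤ ρ) (hπ : ρ ≤ Real.pi) {B : Set S2}
    (hB : MeasurableSet B) : Measurable fun x => sigma (cap x ρ \ B) :=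
  measurable_measure_prodMk_left (s := {p : S2 × S2 | p.2 ∈ cap p.1 ρ} \ (Prod.snd ⁻¹' B))
    ((isOpen_setOf_mem_cap h0 hπ).measurableSet.diff (measurable_snd hB))

namespace IsInnerFrame

variable {γ : ℝ → S2} {n : ℝ → E3} {k : ℝ → ℝ} {A : Set S2} {r : ℝ}

/-- A curve point in the cap would bring the nearest curve point within `ρ`, placing `x` in the
inner half-tube. -/
lemma cap_subset_interior_of_notMem (h : IsInnerFrame γ n k A r) {ρ : ℝ} (hρ : 0 < ρ)
    (hρr : ρ < r) {x : S2} (hx : x ∈ interior A)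
    (hxE : x ∉ h.frame.tubePoint '' (Ico 0 1 ×ˢ Ioo 0 ρ)) : cap x ρ ⊆ interior A := by
  have hr := h.lt_pi_div_two
  have hp := Real.pi_pos
  have hxf : x ∉ frontier A := fun hf => hf.2 hx
  have hdis : Disjoint (cap x ρ) (frontier A) := by
    rw [disjoint_left, h.frontier_eq]
    rintro _ hy ⟨t', rfl⟩
    rw [mem_cap_iff hρ.le (by linarith)] at hy
    obtain ⟨t, ht, s, hs, rfl, hle⟩ := h.frame.exists_eq_tubePoint x
    have hlt : |s| < ρ := by
      have h3 : Real.cos ρ < Real.cos |s| := by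
        rw [Real.cos_abs]
        exact lt_of_lt_of_le hy (hle t')
      by_contra hcon
      exact absurd h3 (not_lt.2 (Real.cos_le_cos_of_nonneg_of_le_pi hρ.le hs (not_lt.1 hcon)))
    rcases lt_trichotomy s 0 with h0 | h0 | h0
    · rw [abs_of_neg h0] at hlt
      have h4 := h.mem_exterior t (-s) (by linarith) (by linarith)
      rw [neg_neg] at h4
      exact absurd (interior_subset hx) (interior_subset h4)
    · rw [h0, h.frame.tubePoint_zero, h.frontier_eq] at hxf
      exact hxf (mem_range_self _)
    · rw [abs_of_pos h0] at hlt
      exact hxE ⟨(t, s), ⟨ht, h0, hlt⟩, rfl⟩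
  rcases subset_interior_or_of_disjoint_frontier (isPreconnected_cap hρ (by linarith)) hdis
    with h1 | h1
  · exact h1
  · have hm : x ∈ cap x ρ := by
      rw [mem_cap_iff hρ.le (by linarith), inner_coe_self, ← Real.cos_zero]
      exact Real.cos_lt_cos_of_nonneg_of_le_pi le_rfl (by linarith) hρ
    exact absurd (interior_subset hx) (interior_subset (h1 hm))

/-- The quantity `M ρ A` in tube coordinates. -/
lemma lintegral_sigma_cap_sdiff (h : IsInnerFrame γ n k A r) {ρ : ℝ} (hρ : 0 < ρ) (hρr : ρ < r) :
    ∫⁻ x in A, sigma (cap x ρ \ A) ∂sigma = ENNReal.ofReal (1 / (4 * Real.pi)) *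
      ∫⁻ w in Ico 0 1 ×ˢ Ioo 0 ρ,
        ENNReal.ofReal (|Real.cos w.2 - k w.1 * Real.sin w.2| * ‖velocity γ w.1‖) *
          sigma (cap (h.frame.tubePoint w) ρ \ interior A) := by
  have hr := h.lt_pi_div_two
  have hp := Real.pi_pos
  -- Passing to the interior replaces `A` by an open, hence measurable, set at the cost of a subset
  -- of the curve.
  have hnull : sigma (A \ interior A) = 0 := by
    refine measure_mono_null ?_ h.frame.sigma_range_curve
    rw [← h.frontier_eq]
    exact sdiff_subset_sdiff_left subset_closure
  have hae : interior A =ᵐ[sigma] A :=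
    (interior_subset.eventuallyLE).antisymm (ae_le_set.2 hnull)
  have hg : Measurable fun x => sigma (cap x ρ \ interior A) :=
    measurable_sigma_cap_sdiff hρ.le (by linarith) isOpen_interior.measurableSet
  have hDm : MeasurableSet (Ico (0 : ℝ) 1 ×ˢ Ioo 0 ρ) := measurableSet_Ico.prod measurableSet_Ioo
  have hinj : InjOn h.frame.tubePoint (Ico (0 : ℝ) 1 ×ˢ Ioo 0 ρ) := by
    refine (h.frame.injOn_tubePoint (h.noOverlap ρ hρ hρr)).mono (prod_mono_right fun s hs => ?_)
    exact ⟨by linarith [hs.1], hs.2.le⟩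
  have hEm : MeasurableSet (h.frame.tubePoint '' (Ico (0 : ℝ) 1 ×ˢ Ioo 0 ρ)) :=
    hDm.image_of_continuousOn_injOn h.frame.continuous_tubePoint.continuousOn hinj
  have hEA : h.frame.tubePoint '' (Ico (0 : ℝ) 1 ×ˢ Ioo 0 ρ) ⊆ interior A := by
    rintro _ ⟨⟨t, s⟩, ⟨-, hs⟩, rfl⟩
    exact h.mem_interior t s hs.1 (hs.2.trans hρr)
  rw [← h.frame.setLIntegral_image_tubePoint hDm hinj hg]
  calc ∫⁻ x in A, sigma (cap x ρ \ A) ∂sigma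
      = ∫⁻ x in interior A, sigma (cap x ρ \ interior A) ∂sigma := by
        rw [setLIntegral_congr hae]
        exact lintegral_congr fun x => measure_congr ((Filter.EventuallyEq.refl _ _).diff hae.symm)
    _ = _ := by
        rw [← lintegral_inter_add_sdiff _ (interior A) hEm, inter_eq_self_of_subset_right hEA]
        have hz : ∫⁻ x in interior A \ h.frame.tubePoint '' (Ico (0 : ℝ) 1 ×ˢ Ioo 0 ρ),
            sigma (cap x ρ \ interior A) ∂sigma = 0 := by
          rw [setLIntegral_congr_fun (g := fun _ => 0)
            (isOpen_interior.measurableSet.diff hEm), lintegral_zero]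
          intro x hx
          simp only
          rw [sdiff_eq_empty.2 (h.cap_subset_interior_of_notMem hρ hρr hx.1 hx.2), measure_empty]
        rw [hz, add_zero]

end IsInnerFrame

/-! ### Assembling the bounds. -/

/-- No sign condition on `g`: the lower integrand `V(s) - 84ρ³/r` may be negative. -/
lemma ofReal_integral_le_lintegral {α : Type*} [MeasurableSpace α] {μ : Measure α} {g : α → ℝ}
    (hg : Integrable g μ) : ENNReal.ofReal (∫ x, g x ∂μ) ≤ ∫⁻ x, ENNReal.ofReal (g x) ∂μ := by
  have h1 := ofReal_integral_eq_lintegral_ofReal hg.pos_part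
    (Filter.Eventually.of_forall fun x => le_max_right (g x) 0)
  have h2 : ∫⁻ x, ENNReal.ofReal (max (g x) 0) ∂μ = ∫⁻ x, ENNReal.ofReal (g x) ∂μ := by
    simp [ENNReal.ofReal_max]
  rw [← h2, ← h1]
  exact ENNReal.ofReal_le_ofReal (integral_mono hg hg.pos_part fun x => le_max_left _ _)

lemma integral_discPartArea_add {ρ : ℝ} (hρ : 0 ≤ ρ) (c : ℝ) :
    ∫ s in Ioo 0 ρ, 1 / (4 * Real.pi) * (discPartArea ρ s + c) =
      1 / (4 * Real.pi) * (2 * ρ ^ 3 / 3 + ρ * c) := by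
  rw [← integral_Ioc_eq_integral_Ioo, ← intervalIntegral.integral_of_le hρ,
    intervalIntegral.integral_const_mul, intervalIntegral.integral_add
      ((continuous_discPartArea ρ).intervalIntegrable _ _) (by simp), integral_discPartArea hρ]
  simp

lemma lintegral_speed {γ : ℝ → S2} (hγ : IsSmoothSimpleClosedCurve γ) :
    ∫⁻ t in Ico (0 : ℝ) 1, ENNReal.ofReal ‖velocity γ t‖ = ENNReal.ofReal (curveLength γ) := by
  have hc : Continuous fun t => ‖velocity γ t‖ := hγ.contDiff_velocity.continuous.norm
  rw [curveLength, intervalIntegral.integral_of_le zero_le_one, ← integral_Ico_eq_integral_Ioc,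
    ofReal_integral_eq_lintegral_ofReal (hc.integrableOn_Icc.mono_set Ico_subset_Icc_self)
      (Filter.Eventually.of_forall fun t => norm_nonneg _)]

lemma curveLength_nonneg (γ : ℝ → S2) : 0 ≤ curveLength γ :=
  intervalIntegral.integral_nonneg zero_le_one fun _ _ => norm_nonneg _

lemma lintegral_speed_mul {γ : ℝ → S2} (hγ : IsSmoothSimpleClosedCurve γ) {ρ : ℝ} {g : ℝ → ENNReal}
    (hg : Measurable g) :
    ∫⁻ w in Ico (0 : ℝ) 1 ×ˢ Ioo 0 ρ, ENNReal.ofReal ‖velocity γ w.1‖ * g w.2 =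
      ENNReal.ofReal (curveLength γ) * ∫⁻ s in Ioo 0 ρ, g s := by
  have hv : Measurable fun t => ENNReal.ofReal ‖velocity γ t‖ :=
    hγ.contDiff_velocity.continuous.measurable.norm.ennreal_ofReal
  rw [Measure.volume_eq_prod, ← Measure.prod_restrict,
    lintegral_prod_mul (f := fun t => ENNReal.ofReal ‖velocity γ t‖) hv.aemeasurable
      hg.aemeasurable, lintegral_speed hγ]

namespace IsInnerFrame

variable {γ : ℝ → S2} {n : ℝ → E3} {k : ℝ → ℝ} {A : Set S2} {r : ℝ}

/-- With `e = ρ³/r`, multiplying `V + 40e` by `1 + 2s/r` adds at most `4e` from `V` and `40e` from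
the old error, hence 84. The lower bound needs less. -/
lemma integrand_bounds (h : IsInnerFrame γ n k A r) {ρ s : ℝ} (hρ : 0 < ρ) (hρr : ρ < r / 2)
    (hs0 : 0 ≤ s) (hs : s ≤ ρ) (t : ℝ) :
    ENNReal.ofReal ‖velocity γ t‖ *
        ENNReal.ofReal (1 / (4 * Real.pi) * (discPartArea ρ s + -(84 * (ρ ^ 3 / r)))) ≤
      ENNReal.ofReal (|Real.cos s - k t * Real.sin s| * ‖velocity γ t‖) *
        sigma (cap (h.frame.tubePoint (t, s)) ρ \ interior A) ∧
    ENNReal.ofReal (|Real.cos s - k t * Real.sin s| * ‖velocity γ t‖) *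
        sigma (cap (h.frame.tubePoint (t, s)) ρ \ interior A) ≤
      ENNReal.ofReal ‖velocity γ t‖ *
        ENNReal.ofReal (1 / (4 * Real.pi) * (discPartArea ρ s + 84 * (ρ ^ 3 / r))) := by
  have hr0 : 0 < r := by linarith
  have hp := Real.pi_pos
  obtain ⟨h1, h2⟩ := h.sigma_cap_sdiff_bounds hρ hρr hs0 hs t
  have h3 := abs_le.1 (h.abs_jacobian_sub_one_le hs0 (hs.trans hρr.le) hr0 t)
  set j := |Real.cos s - k t * Real.sin s| with hj
  have hj0 : 0 ≤ j := abs_nonneg _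
  set e := ρ ^ 3 / r with he
  have he0 : 0 < e := by positivity
  have hV := discPartArea_le hρ.le hs0 hs
  have hV0 := discPartArea_nonneg hs
  set V := discPartArea ρ s
  have hsr : 2 * s / r ≤ 1 := by
    rw [div_le_one hr0]
    linarith
  have hsr0 : 0 ≤ 2 * s / r := by positivity
  have hVs : V * (2 * s / r) ≤ 4 * e := by
    calc V * (2 * s / r) ≤ (2 * ρ ^ 2) * (2 * ρ / r) := by gcongr
      _ = 4 * e := by rw [he]; ring
  rw [mul_comm j, ENNReal.ofReal_mul (norm_nonneg _), mul_assoc]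
  constructor
  · gcongr
    refine le_trans ?_ (mul_le_mul_right h1 _)
    rw [← ENNReal.ofReal_mul hj0]
    by_cases hneg : V - 40 * e ≤ 0
    · rw [ENNReal.ofReal_of_nonpos]
      · exact zero_le
      · exact mul_nonpos_of_nonneg_of_nonpos (by positivity) (by linarith)
    · push Not at hneg
      refine ENNReal.ofReal_le_ofReal ?_
      rw [mul_left_comm]
      refine mul_le_mul_of_nonneg_left ?_ (by positivity)
      have h4 : (1 - 2 * s / r) * (V - 40 * e) ≤ j * (V - 40 * e) := by
        gcongr
        linarith
      nlinarith [mul_nonneg hsr0 he0.le]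
  · gcongr
    refine le_trans (mul_le_mul_right h2 _) ?_
    rw [← ENNReal.ofReal_mul hj0]
    refine ENNReal.ofReal_le_ofReal ?_
    rw [mul_left_comm]
    refine mul_le_mul_of_nonneg_left ?_ (by positivity)
    have h4 : j * (V + 40 * e) ≤ (1 + 2 * s / r) * (V + 40 * e) := by
      gcongr
      linarith
    nlinarith [mul_le_mul_of_nonneg_right hsr he0.le]

theorem lintegral_sigma_cap_sdiff_bounds (h : IsInnerFrame γ n k A r) {ρ : ℝ} (hρ : 0 < ρ)
    (hρr : ρ < r / 2) :
    ENNReal.ofReal (1 / (4 * Real.pi) * (curveLength γ * (1 / (4 * Real.pi) *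
        (2 * ρ ^ 3 / 3 + ρ * -(84 * (ρ ^ 3 / r)))))) ≤ ∫⁻ x in A, sigma (cap x ρ \ A) ∂sigma ∧
      ∫⁻ x in A, sigma (cap x ρ \ A) ∂sigma ≤
        ENNReal.ofReal (1 / (4 * Real.pi) * (curveLength γ * (1 / (4 * Real.pi) *
          (2 * ρ ^ 3 / 3 + ρ * (84 * (ρ ^ 3 / r)))))) := by
  have hp := Real.pi_pos
  have hr0 : 0 < r := by linarith
  have hL := curveLength_nonneg γ
  have hcont : ∀ c : ℝ, Continuous fun s => 1 / (4 * Real.pi) * (discPartArea ρ s + c) := fun c =>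
    continuous_const.mul ((continuous_discPartArea ρ).add continuous_const)
  have hint : ∀ c : ℝ, IntegrableOn (fun s => 1 / (4 * Real.pi) * (discPartArea ρ s + c)) (Ioo 0 ρ) :=
    fun c => (hcont c).integrableOn_Icc.mono_set Ioo_subset_Icc_self
  have hDm : MeasurableSet (Ico (0 : ℝ) 1 ×ˢ Ioo 0 ρ) := measurableSet_Ico.prod measurableSet_Ioo
  rw [h.lintegral_sigma_cap_sdiff hρ (by linarith)]
  constructor
  · rw [ENNReal.ofReal_mul (by positivity), ENNReal.ofReal_mul hL,
      ← integral_discPartArea_add hρ.le]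
    gcongr ENNReal.ofReal (1 / (4 * Real.pi)) * ?_
    refine (mul_le_mul_right (ofReal_integral_le_lintegral (hint _)) _).trans ?_
    rw [← lintegral_speed_mul h.frame.curve (hcont _).measurable.ennreal_ofReal]
    exact setLIntegral_mono' hDm fun w hw =>
      (h.integrand_bounds hρ hρr hw.2.1.le hw.2.2.le w.1).1
  · rw [ENNReal.ofReal_mul (by positivity), ENNReal.ofReal_mul hL,
      ← integral_discPartArea_add hρ.le]
    gcongr ENNReal.ofReal (1 / (4 * Real.pi)) * ?_
    rw [ofReal_integral_eq_lintegral_ofReal (hint _) ?_,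
      ← lintegral_speed_mul h.frame.curve (hcont _).measurable.ennreal_ofReal]
    · exact setLIntegral_mono' hDm fun w hw =>
        (h.integrand_bounds hρ hρr hw.2.1.le hw.2.2.le w.1).2
    · filter_upwards [ae_restrict_mem measurableSet_Ioo] with s hs
      have := discPartArea_nonneg hs.2.le
      have he : 0 < ρ ^ 3 / r := by positivity
      exact mul_nonneg (by positivity) (by linarith)

end IsInnerFrame

end SphereTube

end

theorem mainTheorem7 (A : Set SphereTube.S2) (γ : ℝ → SphereTube.S2)
    (hγ : SphereTube.IsSmoothSimpleClosedCurve γ)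
    (hA : frontier A = Set.range γ)
    (hint : (interior A).Nonempty) (hext : (interior Aᶜ).Nonempty)
    (r : ℝ) (hr : r < Real.pi / 2)
    (htube : ∀ θ : ℝ, 0 < θ → θ < r → SphereTube.TubeNoOverlap γ θ)
    (ρ : ℝ) (hρ : 0 < ρ) (hρr : ρ < r / 2) :
    |SphereTube.M ρ A - SphereTube.curveLength γ * (ρ ^ 3 / (24 * Real.pi ^ 2))| ≤
      SphereTube.curveLength γ * r⁻¹ * ρ ^ 4 := by
  have hr0 : 0 < r := by linarith
  have hp := Real.pi_pos
  obtain ⟨n, k, h⟩ := SphereTube.exists_isInnerFrame hγ hA hint hext hr0 hr htube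
  obtain ⟨hlo, hhi⟩ := h.lintegral_sigma_cap_sdiff_bounds hρ hρr
  have hL := SphereTube.curveLength_nonneg γ
  set L := SphereTube.curveLength γ
  have hfin := ne_top_of_le_ne_top ENNReal.ofReal_ne_top hhi
  have h1 := (ENNReal.ofReal_le_iff_le_toReal hfin).1 hlo
  have h2 := ENNReal.toReal_le_of_le_ofReal (by positivity) hhi
  have e1 : 1 / (4 * Real.pi) * (L * (1 / (4 * Real.pi) *
      (2 * ρ ^ 3 / 3 + ρ * -(84 * (ρ ^ 3 / r))))) =
      L * (ρ ^ 3 / (24 * Real.pi ^ 2)) - 84 / (16 * Real.pi ^ 2) * (L * r⁻¹ * ρ ^ 4) := by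
    field_simp
    ring
  have e2 : 1 / (4 * Real.pi) * (L * (1 / (4 * Real.pi) *
      (2 * ρ ^ 3 / 3 + ρ * (84 * (ρ ^ 3 / r))))) =
      L * (ρ ^ 3 / (24 * Real.pi ^ 2)) + 84 / (16 * Real.pi ^ 2) * (L * r⁻¹ * ρ ^ 4) := by
    field_simp
    ring
  rw [e1] at h1
  rw [e2] at h2
  -- Already `π > 3` suffices, as `16 · 9 = 144`.
  have h3 : 84 / (16 * Real.pi ^ 2) ≤ 1 := by
    rw [div_le_one (by positivity)]
    nlinarith [Real.pi_gt_three]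
  have h4 : 84 / (16 * Real.pi ^ 2) * (L * r⁻¹ * ρ ^ 4) ≤ 1 * (L * r⁻¹ * ρ ^ 4) :=
    mul_le_mul_of_nonneg_right h3 (by positivity)
  rw [abs_le, SphereTube.M]
  constructor <;> linarith
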